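/- Fix an infinite cardinal $\kappa$. Let $\mathbf{Rings}$ be the category of commutative rings of cardinality less than $\kappa$, and $\mathbf{Aff}$ its opposite. A presheaf of groupoids $(X_0,X_1)$ on $\mathbf{Aff}$ is a functor $R\mapsto (X_0(R),X_1(R))$ from $\mathbf{Rings}$ to small groupoids, with object set $X_0(R)$ and morphism set $X_1(R)$; a map of presheaves of groupoids is a natural transformation, given by functors $\Phi(R)$. A flat cover of a ring $R$ is a finite family of flat extensions $\{R\to S_i\}$ such that $\prod_i S_i$ is faithfully flat over $R$. A map $\Phi\colon (X_0,X_1)\to (Y_0,Y_1)$ of presheaves of groupoids is an internal equivalence in the flat topology if $\Phi(R)$ is full and faithful for every $R$, and if for every $R$ and every $y\in Y_0(R)$ there is a flat cover $\{f_i\colon R\to S_i\}$ such that, for each $i$, there are $x_i\in X_0(S_i)$ and a morphism in $Y_1(S_i)$ from $\Phi x_i$ to the image $f_i y$ of $y$ in $Y_0(S_i)$. A quasi-coherent sheaf $M$ over $(X_0,X_1)$ consists of an $R$-module $M_x$ for each ring $R$ and each $x\in X_0(R)$, of $R$-linear maps $\theta(f)\colon M_x\to M_y$ for all ring maps $f\colon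 R\to S$ with $X_0(f)(x)=y$, functorial in $f$ and such that the adjoint $S\otimes_R M_x\to M_y$ of each $\theta(f)$ is an isomorphism, and of $R$-linear isomorphisms $\psi_\alpha\colon M_x\to M_y$ for all morphisms $\alpha\colon x\to y$ in $X_1(R)$, which are natural in $(R,\alpha)$ with respect to $\theta$ and satisfy $\psi_{\beta\alpha}=\psi_\beta\circ\psi_\alpha$ whenever $\beta$ and $\alpha$ are composable. (Equivalently, $M$ is a sheaf over $(X_0,X_1)$ in the trivial topology, whose only covers are isomorphisms, and the adjoints of the $\theta(f)$ are isomorphisms.) A map $\tau\colon M\to N$ consists of $R$-linear maps $\tau_x\colon M_x\to N_x$, for all $R$ and all $x\in X_0(R)$, commuting with $\theta$ and $\psi$. Let $\mathrm{Sh}^{\mathrm{qc}}_{(X_0,X_1)}$ be the resulting category. A map $\Phi\colon (X_0,X_1)\to(Y_0,Y_1)$ induces a functor $\Phi^*\colon \mathrm{Sh}^{\mathrm{qc}}_{(Y_0,Y_1)}\to \mathrm{Sh}^{\mathrm{qc}}_{(X_0,X_1)}$, with $(\Phi^*M)_x=M_{\Phi x}$ and $\psi^{\Phi^*M}_\alpha=\psi^M_{\Phi\alpha}$.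 **Theorem.** Suppose $\Phi\colon (X_0,X_1)\to (Y_0,Y_1)$ is an internal equivalence of presheaves of groupoids on $\mathbf{Aff}$ in the flat topology. Then $\Phi^*\colon \mathrm{Sh}^{\mathrm{qc}}_{(Y_0,Y_1)}\to \mathrm{Sh}^{\mathrm{qc}}_{(X_0,X_1)}$ is an equivalence of categories. -/

import Mathlib

open CategoryTheory Cardinal

universe w v₁ u₁ u

namespace GroupoidSheaves

/-! ### The site -/

/-- Commutative rings of cardinality less than `κ`, as a full subcategory of all commutative rings.
Its opposite category is `Aff`. -/
abbrev Rings (κ : Cardinal.{u}) : Type (u + 1) :=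
  ObjectProperty.FullSubcategory (fun R : CommRingCat.{u} => #R < κ)

variable {κ : Cardinal.{u}}

/-- The underlying type of a ring of cardinality less than `κ`. -/
abbrev Rings.carrier (R : Rings κ) : Type u := R.obj

/-- The ring homomorphism underlying a morphism of `Rings κ`. -/
abbrev Rings.toRingHom {R S : Rings κ} (f : R ⟶ S) : R.carrier →+* S.carrier := f.hom.hom

/-- A notion of cover on `Aff`: it tells which families of ring homomorphisms
`R ⟶ S i` are covers of `R`. -/
abbrev Coverage (κ : Cardinal.{u}) : Type (u + 1) :=
  ∀ (R : Rings κ) (ι : Type) (S : ι → Rings κ), (∀ i, R ⟶ S i) → Prop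

/-- The trivial topology: the only covers are single isomorphisms. -/
def trivialTopology (κ : Cardinal.{u}) : Coverage κ :=
  fun _ ι _ f => Nonempty (Unique ι) ∧ ∀ i, IsIso (f i)

/-- The flat (fpqc) topology: a cover of `R` is a finite family of flat extensions `R ⟶ S i`
such that the product of the `S i` is faithfully flat over `R`. -/
def flatTopology (κ : Cardinal.{u}) : Coverage κ :=
  fun _ ι _ f => Finite ι ∧ (∀ i, (Rings.toRingHom (f i)).Flat) ∧
    (RingHom.pi fun i => Rings.toRingHom (f i)).FaithfullyFlat

/-! ### Presheaves of groupoids -/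

/-- A presheaf of groupoids `(X₀, X₁)` on `Aff`: a (strict) functor from rings to groupoids.
The objects of `X.obj R` are the elements of `X₀(R)`, its morphisms are those of `X₁(R)`. -/
abbrev GpdPresheaf (κ : Cardinal.{u}) := Rings κ ⥤ Grpd.{v₁, u₁}

variable {X Y Z : GpdPresheaf.{v₁, u₁} κ}

/-- The functor of groupoids `X(f) : X(R) ⥤ X(S)` induced by a ring homomorphism `f : R ⟶ S`. -/
abbrev GpdPresheaf.res (X : GpdPresheaf.{v₁, u₁} κ) {R S : Rings κ} (f : R ⟶ S) :
    X.obj R ⥤ X.obj S := X.map f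

/-- The functor of groupoids `Φ(R) : X(R) ⥤ Y(R)`. -/
abbrev GpdPresheaf.at (Φ : X ⟶ Y) (R : Rings κ) : X.obj R ⥤ Y.obj R := Φ.app R

lemma GpdPresheaf.naturality_obj (Φ : X ⟶ Y) {R S : Rings κ} (f : R ⟶ S) (x : X.obj R) :
    (Y.res f).obj ((GpdPresheaf.at Φ R).obj x) = (GpdPresheaf.at Φ S).obj ((X.res f).obj x) :=
  (Functor.congr_obj (show X.res f ⋙ GpdPresheaf.at Φ S = GpdPresheaf.at Φ R ⋙ Y.res f from
    Φ.naturality f) x).symm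

lemma GpdPresheaf.naturality_map (Φ : X ⟶ Y) {R S : Rings κ} (f : R ⟶ S) {x x' : X.obj R}
    (α : x ⟶ x') :
    (GpdPresheaf.at Φ S).map ((X.res f).map α) =
      eqToHom (naturality_obj Φ f x).symm ≫ (Y.res f).map ((GpdPresheaf.at Φ R).map α) ≫
        eqToHom (naturality_obj Φ f x') :=
  Functor.congr_hom (show X.res f ⋙ GpdPresheaf.at Φ S = GpdPresheaf.at Φ R ⋙ Y.res f from
    Φ.naturality f) α

/-- The essential image of `Φ`: the points `(R, y)` of `Y₀` such that there are a point `(R, x)`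
of `X₀` and a morphism from `Φ x` to `y`. -/
def essImage (Φ : X ⟶ Y) (R : Rings κ) : Set (Y.obj R) :=
  {y | ∃ x : X.obj R, Nonempty ((GpdPresheaf.at Φ R).obj x ⟶ y)}

/-- The sheaf-theoretic essential image of `Φ`: the points `(R, y)` of `Y₀` whose restrictions to
the members of some cover of `R` lie in the essential image of `Φ`. -/
def sheafEssImage (T : Coverage κ) (Φ : X ⟶ Y) (R : Rings κ) : Set (Y.obj R) :=
  {y | ∃ (ι : Type) (S : ι → Rings κ) (f : ∀ i, R ⟶ S i), T R ι S f ∧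
    ∀ i, (Y.res (f i)).obj y ∈ essImage Φ (S i)}

/-- Internal equivalences with respect to the topology `T`. -/
structure IsInternalEquivalence (T : Coverage κ) (Φ : X ⟶ Y) : Prop where
  full : ∀ R, (GpdPresheaf.at Φ R).Full
  faithful : ∀ R, (GpdPresheaf.at Φ R).Faithful
  sheafEssImage_eq : ∀ R, sheafEssImage T Φ R = Set.univ

/-! ### Sheaves of modules -/

/-- A presheaf of `𝒪`-modules over the presheaf of sets `X₀`: an `R`-module `M_x` for every point
`(R, x)` of `X₀`, and a map `θ(f) : M_x → M_y`, linear over `f`, for every map of points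
`f : (R, x) ⟶ (S, y)`, that is, for every `f : R ⟶ S` with `X₀(f)(x) = y`. -/
structure ModPresheaf (X : GpdPresheaf.{v₁, u₁} κ) where
  obj : ∀ (R : Rings κ), X.obj R → ModuleCat.{w} R.carrier
  θ : ∀ {R S : Rings κ} (f : R ⟶ S) {x : X.obj R} {y : X.obj S}, (X.res f).obj x = y →
    (obj R x →ₛₗ[Rings.toRingHom f] obj S y)
  θ_id : ∀ {R : Rings κ} {x : X.obj R} (h : (X.res (𝟙 R)).obj x = x) (m : obj R x),
    θ (𝟙 R) h m = m
  θ_comp : ∀ {R S T : Rings κ} (f : R ⟶ S) (g : S ⟶ T) {x : X.obj R} {y : X.obj S} {z : X.obj T}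
    (hf : (X.res f).obj x = y) (hg : (X.res g).obj y = z)
    (hfg : (X.res (f ≫ g)).obj x = z) (m : obj R x), θ (f ≫ g) hfg m = θ g hg (θ f hf m)

/-- The sheaf condition: for every cover `(R, x) ⟶ (S i, x i)`, the module `M_x` is the equalizer
of `∏ M_{x i} ⇉ ∏ M_{x j k}`. Two elements of `M_{x j}` and `M_{x k}` agree over `S j ⊗ S k`
iff they agree over all rings `P` under `S j` and `S k` whose two structure maps from `R` agree,
because `S j ⊗ S k` is the initial such ring. -/
def ModPresheaf.IsSheaf (T : Coverage κ) (M : ModPresheaf.{w} X) : Prop :=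
  ∀ (R : Rings κ) (ι : Type) (S : ι → Rings κ) (f : ∀ i, R ⟶ S i), T R ι S f →
    ∀ (x : X.obj R) (y : ∀ i, X.obj (S i)) (hy : ∀ i, (X.res (f i)).obj x = y i)
      (t : ∀ i, M.obj (S i) (y i)),
      (∀ (j k : ι) (P : Rings κ) (g : S j ⟶ P) (g' : S k ⟶ P) (z : X.obj P)
        (hz : (X.res g).obj (y j) = z) (hz' : (X.res g').obj (y k) = z),
        f j ≫ g = f k ≫ g' → M.θ g hz (t j) = M.θ g' hz' (t k)) →
      ∃! m : M.obj R x, ∀ i, M.θ (f i) (hy i) m = t i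

/-- A sheaf of modules over the presheaf of groupoids `(X₀, X₁)` in the topology `T`: a sheaf `M`
over `X₀` with an isomorphism `ψ : dom^* M ⟶ cod^* M` of sheaves over `X₁` (that is, isomorphisms
`ψ_α : M_x ≃ M_y`, for `α : x ⟶ y` in `X₁(R)`, which are natural in the point `(R, α)` of `X₁`),
satisfying the cocycle condition. -/
structure Sh (T : Coverage κ) (X : GpdPresheaf.{v₁, u₁} κ) extends ModPresheaf.{w} X where
  isSheaf : toModPresheaf.IsSheaf T
  ψ : ∀ {R : Rings κ} {x y : X.obj R}, (x ⟶ y) → (obj R x ≃ₗ[R.carrier] obj R y)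
  ψ_natural : ∀ {R S : Rings κ} (f : R ⟶ S) {x y : X.obj R} (α : x ⟶ y) (m : obj R x),
    ψ ((X.res f).map α) (θ f rfl m) = θ f rfl (ψ α m)
  ψ_comp : ∀ {R : Rings κ} {x y z : X.obj R} (α : x ⟶ y) (β : y ⟶ z) (m : obj R x),
    ψ (α ≫ β) m = ψ β (ψ α m)

variable {T : Coverage κ}

namespace Sh

/-- Maps of sheaves over `(X₀, X₁)`: natural families of linear maps `M_x → N_x` commuting
with `ψ`. -/
@[ext]
structure Hom (M N : Sh.{w} T X) where
  app : ∀ (R : Rings κ) (x : X.obj R), M.obj R x →ₗ[R.carrier] N.obj R x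
  app_θ : ∀ {R S : Rings κ} (f : R ⟶ S) {x : X.obj R} {y : X.obj S}
    (h : (X.res f).obj x = y) (m : M.obj R x), app S y (M.θ f h m) = N.θ f h (app R x m)
  app_ψ : ∀ {R : Rings κ} {x y : X.obj R} (α : x ⟶ y) (m : M.obj R x),
    app R y (M.ψ α m) = N.ψ α (app R x m)

instance : Category (Sh.{w} T X) where
  Hom := Hom
  id M := ⟨fun _ _ => LinearMap.id, fun _ _ _ _ _ => rfl, fun _ _ => rfl⟩
  comp a b := ⟨fun R x => (b.app R x).comp (a.app R x),
    fun f _ _ h m => by simp [a.app_θ f h, b.app_θ f h],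
    fun α m => by simp [a.app_ψ α, b.app_ψ α]⟩

lemma ψ_id (M : Sh.{w} T X) {R : Rings κ} {x : X.obj R} (m : M.obj R x) : M.ψ (𝟙 x) m = m := by
  apply (M.ψ (𝟙 x)).injective
  rw [← M.ψ_comp, Category.id_comp]

/-- Inserting identifications of objects into `ψ` amounts to changing the target of `θ`. -/
lemma ψ_eqToHom_θ (M : Sh.{w} T X) {R S : Rings κ} (f : R ⟶ S) {x : X.obj R}
    {y y' : X.obj S} (h : (X.res f).obj x = y) (e : y = y') (m : M.obj R x) :
    M.ψ (eqToHom e) (M.θ f h m) = M.θ f (h.trans e) m := by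
  subst e
  rw [eqToHom_refl, M.ψ_id]

/-- The sheaf `Φ^* M`, with `(Φ^* M)_x = M_{Φ x}`, `θ(f, x) = θ(f, Φ x)` and `ψ_α = ψ_{Φ α}`. -/
def pullbackObj (Φ : X ⟶ Y) (M : Sh.{w} T Y) : Sh.{w} T X where
  obj R x := M.obj R ((GpdPresheaf.at Φ R).obj x)
  θ f x _ h := M.θ f ((GpdPresheaf.naturality_obj Φ f x).trans (congrArg _ h))
  θ_id _ m := M.θ_id _ m
  θ_comp f g _ _ _ _ _ _ m := M.θ_comp f g _ _ _ m
  isSheaf := by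
    intro R ι S f hf x y hy t ht
    refine M.isSheaf R ι S f hf _ (fun i => (GpdPresheaf.at Φ (S i)).obj (y i))
      (fun i => (GpdPresheaf.naturality_obj Φ (f i) x).trans (congrArg _ (hy i))) t ?_
    intro j k P g g' z hz hz' hg
    have e : (X.res g).obj (y j) = (X.res g').obj (y k) := by
      have h : ∀ {A B : Rings κ} (a : R ⟶ A) (b : A ⟶ B),
          (X.res b).obj ((X.res a).obj x) = (X.res (a ≫ b)).obj x := fun a b =>
        (Functor.congr_obj (show X.res (a ≫ b) = X.res a ⋙ X.res b from X.map_comp a b) x).symm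
      rw [← hy j, ← hy k, h, h, hg]
    have hz₁ := hz
    rw [GpdPresheaf.naturality_obj Φ g] at hz₁
    subst hz₁
    exact ht j k P g g' _ rfl e.symm hg
  ψ α := M.ψ ((GpdPresheaf.at Φ _).map α)
  ψ_natural f x y α m := by
    rw [GpdPresheaf.naturality_map Φ f α, M.ψ_comp, M.ψ_comp, M.ψ_eqToHom_θ, M.ψ_natural,
      M.ψ_eqToHom_θ]
  ψ_comp α β m := by rw [Functor.map_comp, M.ψ_comp]

/-- The functor `Φ^*` from sheaves over `(Y₀, Y₁)` to sheaves over `(X₀, X₁)`. -/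
def pullback (T : Coverage κ) (Φ : X ⟶ Y) : Sh.{w} T Y ⥤ Sh.{w} T X where
  obj M := pullbackObj Φ M
  map {_ _} τ := ⟨fun R x => τ.app R ((GpdPresheaf.at Φ R).obj x),
    fun f _ _ _ m => τ.app_θ f _ m, fun α m => τ.app_ψ ((GpdPresheaf.at Φ _).map α) m⟩

end Sh

/-! ### Quasi-coherent sheaves -/

/-- For a map `θ : M → N` from an `R`-module to an `S`-module which is linear over `f : R → S`,
the adjoint `S ⊗[R] M → N`, `s ⊗ m ↦ s • θ m`, is an isomorphism. -/
def IsBaseChangeAlong {R S : Type*} [CommRing R] [CommRing S] (f : R →+* S) {M N : Type*}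
    [AddCommGroup M] [Module R M] [AddCommGroup N] [Module S N] (θ : M →ₛₗ[f] N) : Prop :=
  letI : Algebra R S := f.toAlgebra
  letI : Module R N := Module.compHom N f
  haveI : IsScalarTower R S N := ⟨fun r s n => mul_smul (f r) s n⟩
  IsBaseChange S (({ toFun := θ, map_add' := θ.map_add, map_smul' := θ.map_smulₛₗ } : M →ₗ[R] N))

/-- A sheaf over `(X₀, X₁)` in the trivial topology is quasi-coherent if, for every map of points
`f : (R, x) ⟶ (S, y)` of `X₀`, the adjoint `S ⊗[R] M_x → M_y` of `θ(f)` is an isomorphism. -/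
def IsQuasiCoherent (X : GpdPresheaf.{v₁, u₁} κ) : ObjectProperty (Sh.{w} (trivialTopology κ) X) :=
  fun M => ∀ {R S : Rings κ} (f : R ⟶ S) {x : X.obj R} {y : X.obj S} (h : (X.res f).obj x = y),
    IsBaseChangeAlong (Rings.toRingHom f) (M.θ f h)

/-- The category of quasi-coherent sheaves over `(X₀, X₁)`: a full subcategory of the category of
sheaves in the trivial topology. -/
abbrev QCoh (X : GpdPresheaf.{v₁, u₁} κ) := (IsQuasiCoherent.{w} X).FullSubcategory

/-- The functor `Φ^*` from quasi-coherent sheaves over `(Y₀, Y₁)` to quasi-coherent sheaves over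
`(X₀, X₁)`, the restriction of the pullback of sheaves. -/
def QCoh.pullback (Φ : X ⟶ Y) : QCoh.{w} Y ⥤ QCoh.{w} X :=
  (IsQuasiCoherent.{w} X).lift
    ((IsQuasiCoherent.{w} Y).ι ⋙ Sh.pullback (trivialTopology κ) Φ)
    (fun M _ _ f _ _ _ => M.property f _)

end GroupoidSheaves

/-!
A sheaf on `X` is a functor on the category whose objects are the points `(R, x)` and whose
morphisms `(R, x) ⟶ (S, x')` are the pairs of a ring map `f : R ⟶ S` and a morphism
`X(f)(x) ⟶ x'`; a pair acts by `ψ ∘ θ(f)` (`Sh.act`, `Sh.ofAct`). The quasi-inverse of `Φ^*` is the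
right Kan extension along the functor induced by `Φ`: it sends `M` to the sheaf `pushforward` of
compatible families `Sections`, indexed by the points of `X` over a given point `y` of `Y`, that is,
by the triples of an algebra `R ⟶ S`, a point `x` of `X(S)` and a morphism from the restriction of
`y` to `Φ x` (`DescentPoint`). Functoriality of this construction in `(R, y)` is mere reindexing.

The content is faithfully flat descent. Since `Φ` is fully faithful, a map between the rings of two
points over `y` lifts to exactly one morphism of points, so the values of `M` at the points over `y`
form a quasi-coherent module on a collection of `R`-algebras closed under tensor products,
which no longer mentions groupoids (`DescentSystem`). Since `Φ` is locally essentially surjective,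
these algebras contain a flat cover `S i` of `R`, and descent says that the module of sections
becomes the value of `M` after base change to any `S i` (`DescentSystem.isBaseChange_eval`). It has
two ingredients. Elements descend (`DescentSystem.exists_tr_inr_eq`), so that sections are the
equalizer of two maps between finite products over the cover; and this equalizer commutes with flat
base change.

As being a base change is local for the flat topology (`isBaseChange_of_faithfullyFlat_family`),
the sections form a quasi-coherent sheaf (`Sections.isBaseChangeAlong_map`), and a quasi-coherent
sheaf on `Y` coincides with the sections of its restriction to `X` (`bijective_unit`); the latter
makes `Φ^*` fully faithful. Finally `Φ^*` is essentially surjective because `x` itself is initial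
among the points over `Φ x`, so that sections over `Φ x` are elements of `M_x` (`counitIso`).

The compatible families live in a large universe. A cover bounds their size (`Sections.small`), and
`pushforward` takes their copy in the universe of the fibres of `M`.
-/

namespace GroupoidSheaves

open TensorProduct

/-! ### Faithfully flat finite families -/

section FaithfullyFlatFamily

variable {R ι : Type*} [CommRing R] {S : ι → Type*} [∀ i, CommRing (S i)] [∀ i, Algebra R (S i)]
  {M N : Type*} [AddCommGroup M] [Module R M] [AddCommGroup N] [Module R N]

lemma piLeft_lTensor [Fintype ι] [DecidableEq ι] (φ : M →ₗ[R] N) (x : (∀ i, S i) ⊗[R] M) (i : ι) :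
    TensorProduct.piLeft R N S (φ.lTensor _ x) i =
      φ.lTensor (S i) (TensorProduct.piLeft R M S x i) := by
  induction x with
  | zero => simp
  | add x y hx hy => simp only [map_add, Pi.add_apply, hx, hy]
  | tmul a m => simp

variable [Finite ι] [Module.FaithfullyFlat R (∀ i, S i)]

variable (S) in
/-- Surjectivity can be tested on the members of a faithfully flat finite family. -/
lemma surjective_of_lTensor_family (φ : M →ₗ[R] N)
    (h : ∀ i, Function.Surjective (φ.lTensor (S i))) : Function.Surjective φ := by
  classical
  have := Fintype.ofFinite ι
  rw [← Module.FaithfullyFlat.lTensor_surjective_iff_surjective R (∀ i, S i) φ]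
  intro y
  choose x hx using fun i => h i (TensorProduct.piLeft R N S y i)
  refine ⟨(TensorProduct.piLeft R M S).symm x, (TensorProduct.piLeft R N S).injective ?_⟩
  funext i
  rw [piLeft_lTensor, LinearEquiv.apply_symm_apply, hx]

variable (S) in
/-- Injectivity can be tested on the members of a faithfully flat finite family. -/
lemma injective_of_lTensor_family (φ : M →ₗ[R] N)
    (h : ∀ i, Function.Injective (φ.lTensor (S i))) : Function.Injective φ := by
  classical
  have := Fintype.ofFinite ι
  rw [← Module.FaithfullyFlat.lTensor_injective_iff_injective R (∀ i, S i) φ]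
  intro x y hxy
  refine (TensorProduct.piLeft R M S).injective (funext fun i => h i ?_)
  rw [← piLeft_lTensor, ← piLeft_lTensor, hxy]

variable (S) in
/-- An element dying in all members of a faithfully flat finite family vanishes. -/
lemma eq_zero_of_one_tmul_family {m : M} (h : ∀ i, (1 : S i) ⊗ₜ[R] m = 0) : m = 0 := by
  classical
  have := Fintype.ofFinite ι
  rw [← Module.FaithfullyFlat.one_tmul_eq_zero_iff R M (A := ∀ i, S i)]
  refine (TensorProduct.piLeft R M S).injective (funext fun i => ?_)
  simp [h]

end FaithfullyFlatFamily

/-! ### Adjoints and flatness -/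

section Adjoint

variable {R A S : Type*} [CommRing R] [CommRing A] [CommRing S] [Algebra R A]
  [Algebra R S] {M N : Type*} [AddCommGroup M] [Module R M] [AddCommGroup N] [Module R N]
  [Module S N] [IsScalarTower R S N]

/-- For an algebra homomorphism `φ : A → S`, an `R`-module `M` and an `S`-module `N`, the adjoint
`A ⊗[R] M → N`, `a ⊗ m ↦ φ a • h m`, of an `R`-linear map `h : M → N`. The `A`-module structure
that `φ` induces on `N` is not recorded. -/
noncomputable def adjoint (φ : A →ₐ[R] S) (h : M →ₗ[R] N) : A ⊗[R] M →ₗ[R] N :=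
  TensorProduct.lift (LinearMap.mk₂ R (fun a m => φ a • h m)
    (fun _ _ _ => by rw [map_add, add_smul]) (fun _ _ _ => by rw [map_smul, smul_assoc])
    (fun _ _ _ => by rw [map_add, smul_add]) (fun _ _ _ => by rw [map_smul, smul_comm]))

@[simp]
lemma adjoint_tmul (φ : A →ₐ[R] S) (h : M →ₗ[R] N) (a : A) (m : M) :
    adjoint φ h (a ⊗ₜ m) = φ a • h m := rfl

lemma adjoint_lTensor {M' : Type*} [AddCommGroup M'] [Module R M'] (φ : A →ₐ[R] S)
    (h : M →ₗ[R] N) (f : M' →ₗ[R] M) (x : A ⊗[R] M') :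
    adjoint φ h (f.lTensor A x) = adjoint φ (h ∘ₗ f) x := by
  induction x with
  | zero => simp
  | add x y hx hy => simp only [map_add, hx, hy]
  | tmul a m => simp

lemma isBaseChange_iff_bijective_adjoint (h : M →ₗ[R] N) :
    IsBaseChange S h ↔ Function.Bijective (adjoint (AlgHom.id R S) h) := by
  rw [IsBaseChange, IsTensorProduct]
  refine iff_of_eq (congrArg (fun g : S ⊗[R] M →ₗ[R] N => Function.Bijective g) ?_)
  ext
  rfl

end Adjoint

section FlatFamily

variable {R A ι : Type*} [CommRing R] [CommRing A] [Algebra R A] [Module.Flat R A]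
  {P : ι → Type*} [∀ i, AddCommGroup (P i)] [∀ i, Module R (P i)]

/-- Flat base change of a submodule of a finite product: `A ⊗[R] E` embeds into the product of the
`A ⊗[R] P i`. -/
lemma eq_zero_of_lTensor_proj [Finite ι] (E : Submodule R (∀ i, P i)) (x : A ⊗[R] E)
    (h : ∀ i, (LinearMap.proj i ∘ₗ E.subtype).lTensor A x = 0) : x = 0 := by
  classical
  have := Fintype.ofFinite ι
  apply Module.Flat.lTensor_preserves_injective_linearMap (M := A) E.subtype E.injective_subtype
  rw [map_zero]
  refine (TensorProduct.piRight R R A P).injective (funext fun i => ?_)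
  have key : ∀ z : A ⊗[R] E, TensorProduct.piRight R R A P (E.subtype.lTensor A z) i =
      (LinearMap.proj i ∘ₗ E.subtype).lTensor A z := fun z => by
    induction z with
    | zero => simp
    | add x y hx hy => simp only [map_add, Pi.add_apply, hx, hy]
    | tmul a m => simp
  rw [key, h, map_zero, Pi.zero_apply]

/-- Flat base change of the equalizer of two maps into a finite product: an element of the base
change equalized by all components comes from the base change of the equalizer. -/
lemma exists_lTensor_eqLocus_proj [Finite ι] {κ : Type*} [Finite κ] {Q : κ → Type*}
    [∀ k, AddCommGroup (Q k)] [∀ k, Module R (Q k)] (u v : (∀ i, P i) →ₗ[R] ∀ k, Q k)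
    (z : A ⊗[R] (∀ i, P i))
    (h : ∀ k, (LinearMap.proj k ∘ₗ u).lTensor A z = (LinearMap.proj k ∘ₗ v).lTensor A z) :
    ∃ x : A ⊗[R] (LinearMap.eqLocus u v), (LinearMap.eqLocus u v).subtype.lTensor A x = z := by
  classical
  have := Fintype.ofFinite κ
  have key : ∀ (u : (∀ i, P i) →ₗ[R] ∀ k, Q k) (z : A ⊗[R] (∀ i, P i)) (k : κ),
      TensorProduct.piRight R R A Q (u.lTensor A z) k =
        (LinearMap.proj k ∘ₗ u).lTensor A z := fun u z k => by
    induction z with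
    | zero => simp
    | add x y hx hy => simp only [map_add, Pi.add_apply, hx, hy]
    | tmul a m => simp
  have hz : z ∈ LinearMap.eqLocus (u.lTensor A) (v.lTensor A) :=
    (TensorProduct.piRight R R A Q).injective (funext fun k => by rw [key, key, h])
  have hz' : z ∈ LinearMap.eqLocus (AlgebraTensorModule.lTensor A A u)
    (AlgebraTensorModule.lTensor A A v) := hz
  rw [Module.Flat.eqLocus_lTensor_eq] at hz'
  exact hz'

end FlatFamily

section Descent

variable {R A ι : Type*} [CommRing R] [CommRing A] [Algebra R A] [Finite ι]
  {T : ι → Type*} [∀ i, CommRing (T i)] [∀ i, Algebra R (T i)] [∀ i, Algebra A (T i)]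
  [∀ i, IsScalarTower R A (T i)] [Module.FaithfullyFlat A (∀ i, T i)]
  {M N : Type*} [AddCommGroup M] [Module R M] [AddCommGroup N] [Module R N] [Module A N]
  [IsScalarTower R A N]
  {P : ι → Type*} [∀ i, AddCommGroup (P i)] [∀ i, Module R (P i)] [∀ i, Module A (P i)]
  [∀ i, Module (T i) (P i)] [∀ i, IsScalarTower R A (P i)] [∀ i, IsScalarTower A (T i) (P i)]
  [∀ i, IsScalarTower R (T i) (P i)]

/-- Being a base change along `R → A` is local on `A` for the faithfully flat topology: the map
`A ⊗[R] M → N` becomes bijective after tensoring with every `T i`, since `N` and, by `hc`, also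
`A ⊗[R] M` then become `P i`. -/
lemma isBaseChange_of_faithfullyFlat_family (g : M →ₗ[R] N) (h : ∀ i, N →ₗ[A] P i)
    (hh : ∀ i, IsBaseChange (T i) (h i))
    (hc : ∀ i, IsBaseChange (T i) ((h i).restrictScalars R ∘ₗ g)) : IsBaseChange A g := by
  let φ : A ⊗[R] M →ₗ[A] N := (TensorProduct.isBaseChange R M A).lift g
  have hφ : ∀ m, φ (1 ⊗ₜ m) = g m := fun m => (TensorProduct.isBaseChange R M A).lift_eq g m
  have hφi : ∀ i, IsBaseChange (T i) (h i ∘ₗ φ) := fun i => by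
    refine IsBaseChange.of_comp (R := R) (TensorProduct.isBaseChange R M A) ?_
    convert hc i using 1
    ext m
    exact congrArg (h i) (hφ m)
  have hb : ∀ i, Function.Bijective (φ.lTensor (T i)) := fun i => by
    have e : (hh i).equiv ∘ φ.lTensor (T i) = (hφi i).equiv := by
      funext x
      induction x with
      | zero => simp
      | add x y hx hy => simp only [Function.comp_apply, map_add] at hx hy ⊢; rw [hx, hy]
      | tmul a m => simp [IsBaseChange.equiv_tmul]
    have hb := (hφi i).equiv.bijective
    rw [← e] at hb
    exact (Function.Bijective.of_comp_iff' (hh i).equiv.bijective _).mp hb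
  have : Function.Bijective φ :=
    ⟨injective_of_lTensor_family T φ fun i => (hb i).1,
      surjective_of_lTensor_family T φ fun i => (hb i).2⟩
  exact IsBaseChange.of_equiv (LinearEquiv.ofBijective φ this) hφ

end Descent

/-! ### Base change along ring homomorphisms -/

section Along

variable {R S S' : Type*} [CommRing R] [CommRing S] [CommRing S'] {f : R →+* S} {g : S →+* S'}
  {h : R →+* S'} {M N P : Type*} [AddCommGroup M] [Module R M] [AddCommGroup N] [Module S N]
  [AddCommGroup P] [Module S' P]

lemma IsBaseChangeAlong.comp {θ : M →ₛₗ[f] N} (hθ : IsBaseChangeAlong f θ) {θ' : N →ₛₗ[g] P}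
    (hθ' : IsBaseChangeAlong g θ') {θ'' : M →ₛₗ[h] P} (hh : g.comp f = h)
    (e : ∀ m, θ'' m = θ' (θ m)) : IsBaseChangeAlong h θ'' := by
  subst hh
  let : Algebra R S := f.toAlgebra
  let : Algebra S S' := g.toAlgebra
  let : Algebra R S' := (g.comp f).toAlgebra
  let : Module R N := Module.compHom N f
  let : Module S P := Module.compHom P g
  let : Module R P := Module.compHom P (g.comp f)
  have : IsScalarTower R S N := ⟨fun r s n => mul_smul (f r) s n⟩
  have : IsScalarTower S S' P := ⟨fun r s n => mul_smul (g r) s n⟩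
  have : IsScalarTower R S' P := ⟨fun r s n => mul_smul (g (f r)) s n⟩
  have : IsScalarTower R S S' := IsScalarTower.of_algebraMap_eq fun _ => rfl
  have : IsScalarTower R S P := ⟨fun r s n => by
    change g (f r * s) • n = g (f r) • g s • n
    rw [map_mul, mul_smul]⟩
  unfold IsBaseChangeAlong at hθ hθ' ⊢
  convert IsBaseChange.comp hθ hθ' using 1
  ext m
  exact e m

lemma IsBaseChangeAlong.of_equiv {M' N' : Type*} [AddCommGroup M'] [Module R M'] [AddCommGroup N']
    [Module S N'] {θ : M →ₛₗ[f] N} (hθ : IsBaseChangeAlong f θ) {θ' : M' →ₛₗ[f] N'}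
    (e : M ≃ₗ[R] M') (e' : N ≃ₗ[S] N') (h : ∀ m, θ' (e m) = e' (θ m)) :
    IsBaseChangeAlong f θ' := by
  let : Algebra R S := f.toAlgebra
  let : Module R N := Module.compHom N f
  let : Module R N' := Module.compHom N' f
  have : IsScalarTower R S N := ⟨fun r s n => mul_smul (f r) s n⟩
  have : IsScalarTower R S N' := ⟨fun r s n => mul_smul (f r) s n⟩
  unfold IsBaseChangeAlong at hθ ⊢
  refine (IsBaseChange.iff_of_equiv_comm e e' ?_).mp hθ
  ext m
  exact h m

/-- The semilinear form of `isBaseChange_of_faithfullyFlat_family`. -/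
lemma isBaseChangeAlong_of_faithfullyFlat_family {ι : Type*} [Finite ι] {T : ι → Type*}
    [∀ i, CommRing (T i)] {k : ∀ i, S →+* T i} (hk : (RingHom.pi k).FaithfullyFlat)
    {Q : ι → Type*} [∀ i, AddCommGroup (Q i)] [∀ i, Module (T i) (Q i)]
    (θ : M →ₛₗ[f] N) (h : ∀ i, N →ₛₗ[k i] Q i) (hh : ∀ i, IsBaseChangeAlong (k i) (h i))
    (θ' : ∀ i, M →ₛₗ[(k i).comp f] Q i) (hθ' : ∀ i, IsBaseChangeAlong _ (θ' i))
    (e : ∀ i m, θ' i m = h i (θ m)) : IsBaseChangeAlong f θ := by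
  let : Algebra R S := f.toAlgebra
  let _ (i : ι) : Algebra S (T i) := (k i).toAlgebra
  let _ (i : ι) : Algebra R (T i) := ((k i).comp f).toAlgebra
  have (i : ι) : IsScalarTower R S (T i) := IsScalarTower.of_algebraMap_eq fun _ => rfl
  let : Module R N := Module.compHom N f
  let _ (i : ι) : Module S (Q i) := Module.compHom (Q i) (k i)
  let _ (i : ι) : Module R (Q i) := Module.compHom (Q i) ((k i).comp f)
  have : IsScalarTower R S N := ⟨fun r s n => mul_smul (f r) s n⟩
  have (i : ι) : IsScalarTower S (T i) (Q i) := ⟨fun r s n => mul_smul (k i r) s n⟩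
  have (i : ι) : IsScalarTower R (T i) (Q i) := ⟨fun r s n => mul_smul (k i (f r)) s n⟩
  have (i : ι) : IsScalarTower R S (Q i) := ⟨fun r s n => by
    change k i (f r * s) • n = k i (f r) • k i s • n
    rw [map_mul, mul_smul]⟩
  have : Module.FaithfullyFlat S (∀ i, T i) := hk
  refine isBaseChange_of_faithfullyFlat_family (T := T) (P := Q) _
    (fun i => { toFun := h i, map_add' := (h i).map_add, map_smul' := (h i).map_smulₛₗ }) hh
    fun i => ?_
  have hθi := hθ' i
  unfold IsBaseChangeAlong at hθi
  convert hθi using 1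
  ext m
  exact (e i m).symm

end Along

/-! ### Descent systems -/

/-- A descent system over `R`: a "quasi-coherent module" on a collection `Pt` of points, each lying
over an `R`-algebra `ring p`. It consists of a `ring p`-module `fib p` for every point and of
transition maps `tr g : fib p → fib q` for *all* algebra homomorphisms `g : ring p → ring q`.
Any two points have a product, lying over the tensor product of their rings; of the universal
property of the latter only the existence of `lift` is recorded. Quasi-coherence
is required only for the maps `inr : ring q → ring (prod p q)`, where it says that
`fib (prod p q)` is `ring p ⊗[R] fib q`. -/
structure DescentSystem (R : Type*) [CommRing R] where
  Pt : Type*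
  ring : Pt → Type*
  [commRing : ∀ p, CommRing (ring p)]
  [algebra : ∀ p, Algebra R (ring p)]
  fib : Pt → Type*
  [addCommGroup : ∀ p, AddCommGroup (fib p)]
  [baseModule : ∀ p, Module R (fib p)]
  [module : ∀ p, Module (ring p) (fib p)]
  [isScalarTower : ∀ p, IsScalarTower R (ring p) (fib p)]
  tr : ∀ {p q}, (ring p →ₐ[R] ring q) → fib p →ₗ[R] fib q
  tr_smul : ∀ {p q} (g : ring p →ₐ[R] ring q) (a : ring p) (m : fib p),
    tr g (a • m) = g a • tr g m
  tr_id : ∀ {p} (m : fib p), tr (AlgHom.id R (ring p)) m = m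
  tr_comp : ∀ {p q r} (g : ring p →ₐ[R] ring q) (h : ring q →ₐ[R] ring r) (m : fib p),
    tr (h.comp g) m = tr h (tr g m)
  prod : Pt → Pt → Pt
  inl : ∀ p q, ring p →ₐ[R] ring (prod p q)
  inr : ∀ p q, ring q →ₐ[R] ring (prod p q)
  lift : ∀ {p q r}, (ring p →ₐ[R] ring r) → (ring q →ₐ[R] ring r) →
    (ring (prod p q) →ₐ[R] ring r)
  lift_inl : ∀ {p q r} (g : ring p →ₐ[R] ring r) (h : ring q →ₐ[R] ring r),
    (lift g h).comp (inl p q) = g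
  lift_inr : ∀ {p q r} (g : ring p →ₐ[R] ring r) (h : ring q →ₐ[R] ring r),
    (lift g h).comp (inr p q) = h
  bijective_adjoint : ∀ p q, Function.Bijective (adjoint (inl p q) (tr (inr p q)))

namespace DescentSystem

attribute [instance] commRing algebra addCommGroup baseModule module isScalarTower

variable {R : Type*} [CommRing R] (D : DescentSystem R)

/-- The sections of a descent system: the compatible families of elements of the fibres. -/
def sections : Submodule R (∀ p, D.fib p) where
  carrier := {t | ∀ p q (g : D.ring p →ₐ[R] D.ring q), D.tr g (t p) = t q}
  add_mem' ha hb p q g := by simp [ha p q g, hb p q g]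
  zero_mem' p q g := by simp
  smul_mem' r t ht p q g := by simp [ht p q g]

/-- The value of a section at a point. -/
def eval (p : D.Pt) : D.sections →ₗ[R] D.fib p := LinearMap.proj p ∘ₗ D.sections.subtype

lemma tr_eval {p q : D.Pt} (g : D.ring p →ₐ[R] D.ring q) (t : D.sections) :
    D.tr g (D.eval p t) = D.eval q t := t.2 p q g

lemma sections_ext {t t' : D.sections} (h : ∀ p, D.eval p t = D.eval p t') : t = t' :=
  Subtype.ext (funext h)

/-- A point whose ring is a quotient of `R` mapping to all rings of the system is initial: a section
is determined by its value there, which is arbitrary. -/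
lemma bijective_eval_of_initial (p : D.Pt) (hp : Function.Surjective (algebraMap R (D.ring p)))
    (g : ∀ q, D.ring p →ₐ[R] D.ring q) : Function.Bijective (D.eval p) := by
  have uniq : ∀ {q} (a b : D.ring p →ₐ[R] D.ring q), a = b := fun a b => by
    ext x
    obtain ⟨r, rfl⟩ := hp x
    simp
  refine ⟨fun t t' h => D.sections_ext fun q => ?_, fun m => ⟨⟨fun q => D.tr (g q) m, ?_⟩, ?_⟩⟩
  · rw [← D.tr_eval (g q), h, D.tr_eval]
  · intro q r h
    rw [← D.tr_comp, uniq (h.comp (g q))]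
  · change D.tr (g p) m = m
    rw [uniq (g p) (AlgHom.id R _), D.tr_id]

lemma tr_adjoint {A : Type*} [CommRing A] [Algebra R A] {M : Type*} [AddCommGroup M] [Module R M]
    {p q : D.Pt} (g : D.ring p →ₐ[R] D.ring q) (φ : A →ₐ[R] D.ring p) (h : M →ₗ[R] D.fib p)
    (x : A ⊗[R] M) :
    D.tr g (adjoint φ h x) = adjoint (g.comp φ) (D.tr g ∘ₗ h) x := by
  induction x with
  | zero => simp
  | add x y hx hy => simp only [map_add, hx, hy]
  | tmul a m => simp [D.tr_smul]

/-- The map `ring p ⊗ ring q → ring p ⊗ ring r` induced by `g : ring q → ring r`. -/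
def mapRight (p : D.Pt) {q r : D.Pt} (g : D.ring q →ₐ[R] D.ring r) :
    D.ring (D.prod p q) →ₐ[R] D.ring (D.prod p r) :=
  D.lift (D.inl p r) ((D.inr p r).comp g)

lemma mapRight_inl (p : D.Pt) {q r : D.Pt} (g : D.ring q →ₐ[R] D.ring r) :
    (D.mapRight p g).comp (D.inl p q) = D.inl p r := D.lift_inl _ _

lemma tr_mapRight_inl (p : D.Pt) {q r : D.Pt} (g : D.ring q →ₐ[R] D.ring r) (m : D.fib p) :
    D.tr (D.mapRight p g) (D.tr (D.inl p q) m) = D.tr (D.inl p r) m := by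
  rw [← D.tr_comp, mapRight_inl]

lemma tr_mapRight_inr (p : D.Pt) {q r : D.Pt} (g : D.ring q →ₐ[R] D.ring r) (m : D.fib q) :
    D.tr (D.mapRight p g) (D.tr (D.inr p q) m) = D.tr (D.inr p r) (D.tr g m) := by
  rw [← D.tr_comp, ← D.tr_comp, mapRight, D.lift_inr]

lemma adjoint_tr_inr_comp (p : D.Pt) {q r : D.Pt} (g : D.ring q →ₐ[R] D.ring r)
    (x : D.ring p ⊗[R] D.fib q) :
    adjoint (D.inl p r) (D.tr (D.inr p r) ∘ₗ D.tr g) x =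
      D.tr (D.mapRight p g) (adjoint (D.inl p q) (D.tr (D.inr p q)) x) := by
  rw [D.tr_adjoint, mapRight_inl]
  congr 2
  ext m
  exact (D.tr_mapRight_inr p g m).symm

section Cover

variable {ι : Type*} (c : ι → D.Pt)

/-- The matching families on a cover, as an equalizer of maps between finite products. -/
def matching : Submodule R (∀ i, D.fib (c i)) :=
  LinearMap.eqLocus
    (LinearMap.pi fun jk : ι × ι => D.tr (D.inl (c jk.1) (c jk.2)) ∘ₗ LinearMap.proj jk.1)
    (LinearMap.pi fun jk : ι × ι => D.tr (D.inr (c jk.1) (c jk.2)) ∘ₗ LinearMap.proj jk.2)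

lemma mem_matching {t : ∀ i, D.fib (c i)} : t ∈ D.matching c ↔
    ∀ j k, D.tr (D.inl (c j) (c k)) (t j) = D.tr (D.inr (c j) (c k)) (t k) :=
  ⟨fun h j k => congrFun h (j, k), fun h => funext fun jk => h jk.1 jk.2⟩

/-- The members of a matching family agree over every point mapping to both, since the two
maps factor through the product. -/
lemma tr_eq_tr_of_mem_matching {t : ∀ i, D.fib (c i)} (ht : t ∈ D.matching c) {p : D.Pt} {j k : ι}
    (g : D.ring (c j) →ₐ[R] D.ring p) (h : D.ring (c k) →ₐ[R] D.ring p) :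
    D.tr g (t j) = D.tr h (t k) := by
  have e := congrArg (D.tr (D.lift g h)) ((D.mem_matching c).mp ht j k)
  rwa [← D.tr_comp, ← D.tr_comp, D.lift_inl, D.lift_inr] at e

/-- The members of a family in `ring (c l) ⊗[R] matching`, seen over `prod (c l) (c i)`, are the
restrictions of its value at `c l`. -/
lemma adjoint_lTensor_proj (l i : ι) (x : D.ring (c l) ⊗[R] D.matching c) :
    adjoint (D.inl (c l) (c i)) (D.tr (D.inr (c l) (c i)))
      ((LinearMap.proj i ∘ₗ (D.matching c).subtype).lTensor _ x) =
    D.tr (D.inl (c l) (c i)) (adjoint (AlgHom.id R (D.ring (c l)))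
      (LinearMap.proj l ∘ₗ (D.matching c).subtype) x) := by
  rw [adjoint_lTensor, D.tr_adjoint, AlgHom.comp_id]
  congr 2
  ext t
  exact ((D.mem_matching c).mp t.2 l i).symm

variable [Finite ι] [Module.FaithfullyFlat R (∀ i, D.ring (c i))]

/-- Separatedness: an element vanishing on the cover `prod (c i) p` of `p` is zero. -/
lemma eq_zero_of_tr_inr {p : D.Pt} {m : D.fib p} (h : ∀ i, D.tr (D.inr (c i) p) m = 0) :
    m = 0 :=
  eq_zero_of_one_tmul_family (fun i => D.ring (c i)) fun i =>
    (D.bijective_adjoint (c i) p).1 (by simp [h])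

lemma eq_of_tr_inr {p : D.Pt} {m m' : D.fib p}
    (h : ∀ i, D.tr (D.inr (c i) p) m = D.tr (D.inr (c i) p) m') : m = m' :=
  sub_eq_zero.mp (D.eq_zero_of_tr_inr c fun i => by rw [map_sub, h, sub_self])

lemma eq_of_tr_inl (i : ι) {m m' : D.fib (c i)}
    (h : ∀ j, D.tr (D.inl (c i) (c j)) m = D.tr (D.inl (c i) (c j)) m') : m = m' :=
  D.eq_of_tr_inr c fun j => by
    rw [← D.lift_inl (D.inr (c j) (c i)) (D.inl (c j) (c i)), D.tr_comp, h, ← D.tr_comp]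

/-- Sections are determined by their values on a cover. -/
lemma injective_eval_cover : Function.Injective fun (t : D.sections) i => D.eval (c i) t := by
  intro t t' h
  refine D.sections_ext fun p => D.eq_of_tr_inr c fun i => ?_
  rw [D.tr_eval, D.tr_eval, ← D.tr_eval (D.inl (c i) p), ← D.tr_eval (D.inl (c i) p),
    show D.eval (c i) t = D.eval (c i) t' from congrFun h i]

variable [∀ i, Module.Flat R (D.ring (c i))]

/-- Elements descend: a family on the cover `prod (c i) p` of `p` that matches over all
`prod (c j) (prod (c i) p)` comes from an element over `p`. This holds since, after base change
to `ring (c j)`, such a family is the restriction of its `j`-th member. -/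
lemma exists_tr_inr_eq (p : D.Pt) (u : ∀ i, D.fib (D.prod (c i) p))
    (hu : ∀ j k, D.tr (D.mapRight (c j) (D.inr (c k) p)) (u j) =
      D.tr (D.inr (c j) (D.prod (c k) p)) (u k)) :
    ∃ m : D.fib p, ∀ i, D.tr (D.inr (c i) p) m = u i := by
  let E : Submodule R (∀ i, D.fib (D.prod (c i) p)) :=
    { carrier := {u | ∀ j k, D.tr (D.mapRight (c j) (D.inr (c k) p)) (u j) =
        D.tr (D.inr (c j) (D.prod (c k) p)) (u k)}
      add_mem' := fun hu hv j k => by simp [hu j k, hv j k]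
      zero_mem' := fun j k => by simp
      smul_mem' := fun r u hu j k => by simp [hu j k] }
  let φ : D.fib p →ₗ[R] E :=
    (LinearMap.pi fun i => D.tr (D.inr (c i) p)).codRestrict E fun m j k =>
      D.tr_mapRight_inr (c j) (D.inr (c k) p) m
  suffices h : Function.Surjective φ by
    obtain ⟨m, hm⟩ := h ⟨u, hu⟩
    exact ⟨m, fun i => congrFun (congrArg Subtype.val hm) i⟩
  refine surjective_of_lTensor_family (fun i => D.ring (c i)) φ fun l y => ?_
  induction y with
  | zero => exact ⟨0, map_zero _⟩
  | add x y hx hy =>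
    obtain ⟨x, rfl⟩ := hx
    obtain ⟨y, rfl⟩ := hy
    exact ⟨x + y, map_add _ _ _⟩
  | tmul s e =>
    obtain ⟨x, hx⟩ := (D.bijective_adjoint (c l) p).2 (D.inl (c l) p s • e.1 l)
    refine ⟨x, sub_eq_zero.mp (eq_zero_of_lTensor_proj E _ fun i => ?_)⟩
    rw [map_sub, sub_eq_zero]
    apply (D.bijective_adjoint (c l) (D.prod (c i) p)).1
    rw [adjoint_lTensor, adjoint_lTensor]
    refine (D.adjoint_tr_inr_comp (c l) (D.inr (c i) p) x).trans ?_
    rw [hx, D.tr_smul, e.2 l i, ← AlgHom.comp_apply, D.mapRight_inl]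
    rfl

/-- Matching families on a cover extend to sections. -/
lemma exists_section_of_mem_matching {t : ∀ i, D.fib (c i)} (ht : t ∈ D.matching c) :
    ∃ s : D.sections, ∀ i, D.eval (c i) s = t i := by
  have h : ∀ p, ∃ m : D.fib p, ∀ i, D.tr (D.inr (c i) p) m = D.tr (D.inl (c i) p) (t i) :=
    fun p => D.exists_tr_inr_eq c p _ fun j k => by
      rw [← D.tr_comp, ← D.tr_comp]
      exact D.tr_eq_tr_of_mem_matching c ht _ _
  choose s hs using h
  refine ⟨⟨s, fun p q g => D.eq_of_tr_inr c fun i => ?_⟩, fun l => D.eq_of_tr_inr c fun i => ?_⟩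
  · rw [← D.tr_mapRight_inr, hs, D.tr_mapRight_inl, hs]
  · exact (hs (c l) i).trans (D.tr_eq_tr_of_mem_matching c ht _ _)

/-- The restriction of sections to a cover. -/
noncomputable def sectionsEquivMatching : D.sections ≃ₗ[R] D.matching c :=
  LinearEquiv.ofBijective
    ((LinearMap.pi fun i => D.eval (c i)).codRestrict (D.matching c) fun t => by
      rw [mem_matching]
      intro j k
      simp only [LinearMap.pi_apply, tr_eval])
    ⟨fun _ _ h => D.injective_eval_cover c (congrArg Subtype.val h), fun t => by
      obtain ⟨s, hs⟩ := D.exists_section_of_mem_matching c t.2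
      exact ⟨s, Subtype.ext (funext hs)⟩⟩

/-- Effectivity of descent for matching families on a cover. Composed with the restriction from
`c l` to the points `prod (c l) (c i)`, the map `ring (c l) ⊗[R] matching → fib (c l)` becomes the
embedding of the base change of the equalizer into
`∏ i, ring (c l) ⊗[R] fib (c i) ≃ ∏ i, fib (prod (c l) (c i))`, whose image contains the
restrictions of all elements of `fib (c l)`. -/
lemma isBaseChange_matching (l : ι) :
    IsBaseChange (D.ring (c l)) (LinearMap.proj (φ := fun i => D.fib (c i)) l ∘ₗ
      (D.matching c).subtype) := by
  rw [isBaseChange_iff_bijective_adjoint]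
  refine ⟨(injective_iff_map_eq_zero _).mpr fun x hx => eq_zero_of_lTensor_proj _ x fun i => ?_,
    fun m => ?_⟩
  · apply (D.bijective_adjoint (c l) (c i)).1
    rw [adjoint_lTensor_proj, hx, map_zero, map_zero]
  · choose z hz using fun i => (D.bijective_adjoint (c l) (c i)).2 (D.tr (D.inl (c l) (c i)) m)
    classical
    have := Fintype.ofFinite ι
    let z' : D.ring (c l) ⊗[R] (∀ i, D.fib (c i)) := (TensorProduct.piRight R R _ _).symm z
    have hz' : ∀ i, (LinearMap.proj i).lTensor _ z' = z i := fun i => by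
      have key : ∀ y, (LinearMap.proj i).lTensor _ y =
          TensorProduct.piRight R R (D.ring (c l)) (fun i => D.fib (c i)) y i := fun y => by
        induction y with
        | zero => simp
        | add x y hx hy => simp only [map_add, Pi.add_apply, hx, hy]
        | tmul a m => simp
      rw [key, LinearEquiv.apply_symm_apply]
    obtain ⟨x, hx⟩ : ∃ x : D.ring (c l) ⊗[R] D.matching c,
        (D.matching c).subtype.lTensor _ x = z' := by
      refine exists_lTensor_eqLocus_proj _ _ z' fun jk => ?_
      rw [LinearMap.proj_pi, LinearMap.proj_pi, LinearMap.lTensor_comp, LinearMap.lTensor_comp,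
        LinearMap.comp_apply, LinearMap.comp_apply, hz', hz']
      apply (D.bijective_adjoint (c l) (D.prod (c jk.1) (c jk.2))).1
      rw [adjoint_lTensor, adjoint_lTensor, adjoint_tr_inr_comp, adjoint_tr_inr_comp, hz, hz,
        D.tr_mapRight_inl, D.tr_mapRight_inl]
    refine ⟨x, D.eq_of_tr_inl c l fun i => ?_⟩
    rw [← adjoint_lTensor_proj, LinearMap.lTensor_comp, LinearMap.comp_apply, hx, hz', hz]

/-- Effectivity of descent: over the members of a faithfully flat cover, a descent system is the
base change of its module of sections. -/
lemma isBaseChange_eval (l : ι) : IsBaseChange (D.ring (c l)) (D.eval (c l)) := by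
  have h : D.eval (c l) = (LinearMap.proj (φ := fun i => D.fib (c i)) l ∘ₗ
      (D.matching c).subtype) ∘ₗ (D.sectionsEquivMatching c).toLinearMap := by
    ext t
    rfl
  rw [h]
  exact IsBaseChange.comp_equiv _ _ (D.isBaseChange_matching c l)

end Cover
end DescentSystem

variable {κ : Cardinal.{u}} {X Y : GpdPresheaf.{v₁, u₁} κ} {T : Coverage κ}

/-! ### Sheaves as functors on the category of points -/

namespace GpdPresheaf

lemma res_id_obj {R : Rings κ} (x : X.obj R) : (X.res (𝟙 R)).obj x = x :=
  Functor.congr_obj (show X.res (𝟙 R) = 𝟭 _ from X.map_id R) x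

lemma res_comp_obj {R S S' : Rings κ} (f : R ⟶ S) (g : S ⟶ S') (x : X.obj R) :
    (X.res (f ≫ g)).obj x = (X.res g).obj ((X.res f).obj x) :=
  Functor.congr_obj (show X.res (f ≫ g) = X.res f ⋙ X.res g from X.map_comp f g) x

lemma res_id_map {R : Rings κ} {x y : X.obj R} (α : x ⟶ y) :
    (X.res (𝟙 R)).map α = eqToHom (res_id_obj x) ≫ α ≫ eqToHom (res_id_obj y).symm :=
  Functor.congr_hom (show X.res (𝟙 R) = 𝟭 _ from X.map_id R) α

lemma res_comp_map {R S S' : Rings κ} (f : R ⟶ S) (g : S ⟶ S') {x y : X.obj R} (α : x ⟶ y) :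
    (X.res (f ≫ g)).map α = eqToHom (res_comp_obj f g x) ≫ (X.res g).map ((X.res f).map α) ≫
      eqToHom (res_comp_obj f g y).symm :=
  Functor.congr_hom (show X.res (f ≫ g) = X.res f ⋙ X.res g from X.map_comp f g) α

lemma res_comp_obj_of_eq {R S S' : Rings κ} {f : R ⟶ S} {g : S ⟶ S'} {h : R ⟶ S'}
    (e : f ≫ g = h) (x : X.obj R) : (X.res h).obj x = (X.res g).obj ((X.res f).obj x) :=
  e ▸ res_comp_obj f g x

end GpdPresheaf

open GpdPresheaf

/-- Every presheaf of modules is a sheaf in the trivial topology. -/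
lemma ModPresheaf.isSheaf_trivialTopology (M : ModPresheaf.{w} X) :
    M.IsSheaf (trivialTopology κ) := by
  rintro R ι S f ⟨⟨hι⟩, hf⟩ x y hy t -
  have := hf default
  have hinv : (X.res (inv (f default))).obj (y default) = x := by
    rw [← hy, ← res_comp_obj, IsIso.hom_inv_id, res_id_obj]
  have θ_eq : ∀ {A : Rings κ} {a : X.obj A} (g : A ⟶ A) (_ : g = 𝟙 A) (e : (X.res g).obj a = a)
      (m : M.obj A a), M.θ g e m = m := by
    rintro A a _ rfl e m
    exact M.θ_id e m
  refine ⟨M.θ (inv (f default)) hinv (t default), fun i => ?_, fun m hm => ?_⟩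
  · obtain rfl := Subsingleton.elim default i
    have e : (X.res (inv (f default) ≫ f default)).obj (y default) = y default := by
      rw [IsIso.inv_hom_id, res_id_obj]
    rw [← M.θ_comp _ _ _ _ e, θ_eq _ (IsIso.inv_hom_id _)]
  · have e : (X.res (f default ≫ inv (f default))).obj x = x := by
      rw [IsIso.hom_inv_id, res_id_obj]
    rw [← hm default, ← M.θ_comp _ _ _ _ e, θ_eq _ (IsIso.hom_inv_id _)]

namespace Sh

/-- The map `ψ_α ∘ θ(f) : M_x → M_y` for a ring map `f : R → S` and a morphism `α : X(f)(x) ⟶ y`.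
Such pairs `(f, α)` are the morphisms `(R, x) ⟶ (S, y)` of the category of points of `X`, on which a
sheaf is a functor. -/
def act (M : Sh.{w} T X) {R S : Rings κ} (f : R ⟶ S) {x : X.obj R} {y : X.obj S}
    (α : (X.res f).obj x ⟶ y) : M.obj R x →ₛₗ[Rings.toRingHom f] M.obj S y :=
  (M.ψ α).toLinearMap.comp (M.θ f rfl)

lemma act_apply (M : Sh.{w} T X) {R S : Rings κ} (f : R ⟶ S) {x : X.obj R} {y : X.obj S}
    (α : (X.res f).obj x ⟶ y) (m : M.obj R x) : M.act f α m = M.ψ α (M.θ f rfl m) := rfl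

lemma act_eqToHom (M : Sh.{w} T X) {R S : Rings κ} (f : R ⟶ S) {x : X.obj R} {y : X.obj S}
    (h : (X.res f).obj x = y) (m : M.obj R x) : M.act f (eqToHom h) m = M.θ f h m :=
  M.ψ_eqToHom_θ f rfl h m

lemma act_comp (M : Sh.{w} T X) {R S S' : Rings κ} (f : R ⟶ S) (g : S ⟶ S') {x : X.obj R}
    {y : X.obj S} {z : X.obj S'} (α : (X.res f).obj x ⟶ y) (β : (X.res g).obj y ⟶ z)
    (m : M.obj R x) :
    M.act g β (M.act f α m) =
      M.act (f ≫ g) (eqToHom (res_comp_obj f g x) ≫ (X.res g).map α ≫ β) m := by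
  rw [act_apply, act_apply, act_apply, ← M.ψ_natural, M.ψ_comp, M.ψ_comp, M.ψ_eqToHom_θ,
    M.θ_comp f g rfl rfl]

lemma act_id (M : Sh.{w} T X) {R : Rings κ} {x y : X.obj R} (α : x ⟶ y) (m : M.obj R x) :
    M.act (𝟙 R) (eqToHom (res_id_obj x) ≫ α) m = M.ψ α m := by
  rw [act_apply, M.ψ_comp, M.ψ_eqToHom_θ, M.θ_id]

lemma Hom.app_act {M N : Sh.{w} T X} (τ : Hom M N) {R S : Rings κ} (f : R ⟶ S) {x : X.obj R}
    {y : X.obj S} (α : (X.res f).obj x ⟶ y) (m : M.obj R x) :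
    τ.app S y (M.act f α m) = N.act f α (τ.app R x m) := by
  rw [act_apply, act_apply, τ.app_ψ, τ.app_θ]

/-- Maps of sheaves are natural transformations of functors on the category of points. -/
def Hom.ofAct {M N : Sh.{w} T X} (app : ∀ (R : Rings κ) (x : X.obj R),
      M.obj R x →ₗ[R.carrier] N.obj R x)
    (h : ∀ {R S : Rings κ} (f : R ⟶ S) {x : X.obj R} {y : X.obj S} (α : (X.res f).obj x ⟶ y)
      (m : M.obj R x), app S y (M.act f α m) = N.act f α (app R x m)) : Hom M N where
  app := app
  app_θ f x y e m := by rw [← act_eqToHom, h, act_eqToHom]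
  app_ψ α m := by rw [← act_id, h, act_id]

/-- Equal ring maps act equally, up to the transport of the source of the morphism. -/
lemma congr_of_eqToHom {obj : ∀ (R : Rings κ), X.obj R → ModuleCat.{w} R.carrier}
    (act : ∀ {R S : Rings κ} (f : R ⟶ S) {x : X.obj R} {y : X.obj S}, ((X.res f).obj x ⟶ y) →
      (obj R x →ₛₗ[Rings.toRingHom f] obj S y))
    {R S : Rings κ} {f g : R ⟶ S} (e : f = g) {x : X.obj R} {y : X.obj S}
    {α : (X.res f).obj x ⟶ y} {β : (X.res g).obj x ⟶ y}
    (h : α = eqToHom (by rw [e]) ≫ β) (m : obj R x) : act f α m = act g β m := by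
  subst e h
  simp

/-- The sheaf in the trivial topology given by a functor on the category of points. -/
def ofAct (obj : ∀ (R : Rings κ), X.obj R → ModuleCat.{w} R.carrier)
    (act : ∀ {R S : Rings κ} (f : R ⟶ S) {x : X.obj R} {y : X.obj S}, ((X.res f).obj x ⟶ y) →
      (obj R x →ₛₗ[Rings.toRingHom f] obj S y))
    (act_id : ∀ {R : Rings κ} {x : X.obj R} (m : obj R x), act (𝟙 R) (eqToHom (res_id_obj x)) m = m)
    (act_comp : ∀ {R S S' : Rings κ} (f : R ⟶ S) (g : S ⟶ S') {x : X.obj R}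
      {y : X.obj S} {z : X.obj S'} (α : (X.res f).obj x ⟶ y) (β : (X.res g).obj y ⟶ z)
      (m : obj R x), act g β (act f α m) =
        act (f ≫ g) (eqToHom (res_comp_obj f g x) ≫ (X.res g).map α ≫ β) m) :
    Sh.{w} (trivialTopology κ) X :=
  let M : ModPresheaf.{w} X :=
    { obj := obj
      θ := fun f x y h => act f (eqToHom h)
      θ_id := fun h m => act_id m
      θ_comp := fun f g x y z hf hg hfg m => by
        rw [act_comp]
        simp [eqToHom_map] }
  { M with
    isSheaf := M.isSheaf_trivialTopology
    ψ := fun {R x y} α =>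
      { toFun := act (𝟙 R) (eqToHom (res_id_obj x) ≫ α)
        invFun := act (𝟙 R) (eqToHom (res_id_obj y) ≫ Groupoid.inv α)
        map_add' := map_add _
        map_smul' := fun r m => (act (𝟙 R) (eqToHom (res_id_obj x) ≫ α)).map_smulₛₗ r m
        left_inv := fun m => by
          rw [act_comp]
          refine (congr_of_eqToHom act (Category.id_comp _) ?_ m).trans (act_id m)
          simp [res_id_map]
        right_inv := fun m => by
          rw [act_comp]
          refine (congr_of_eqToHom act (Category.id_comp _) ?_ m).trans (act_id m)
          simp [res_id_map] }
    ψ_natural := fun f x y α m => by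
      change act _ _ (act _ _ m) = act _ _ (act _ _ m)
      rw [act_comp, act_comp]
      refine congr_of_eqToHom act (by rw [Category.id_comp, Category.comp_id]) ?_ m
      simp [res_id_map, eqToHom_map]
    ψ_comp := fun α β m => by
      change act _ _ m = act _ _ (act _ _ m)
      rw [act_comp]
      refine congr_of_eqToHom act (Category.id_comp _).symm ?_ m
      simp [res_id_map] }

lemma act_ofAct (obj : ∀ (R : Rings κ), X.obj R → ModuleCat.{w} R.carrier)
    (act : ∀ {R S : Rings κ} (f : R ⟶ S) {x : X.obj R} {y : X.obj S}, ((X.res f).obj x ⟶ y) →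
      (obj R x →ₛₗ[Rings.toRingHom f] obj S y))
    (act_id : ∀ {R : Rings κ} {x : X.obj R} (m : obj R x), act (𝟙 R) (eqToHom (res_id_obj x)) m = m)
    (act_comp : ∀ {R S S' : Rings κ} (f : R ⟶ S) (g : S ⟶ S') {x : X.obj R}
      {y : X.obj S} {z : X.obj S'} (α : (X.res f).obj x ⟶ y) (β : (X.res g).obj y ⟶ z)
      (m : obj R x), act g β (act f α m) =
        act (f ≫ g) (eqToHom (res_comp_obj f g x) ≫ (X.res g).map α ≫ β) m)
    {R S : Rings κ} (f : R ⟶ S) {x : X.obj R} {y : X.obj S} (α : (X.res f).obj x ⟶ y)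
    (m : obj R x) : (ofAct obj act act_id act_comp).act f α m = act f α m := by
  change act _ _ (act _ _ m) = _
  rw [act_comp]
  refine congr_of_eqToHom act (Category.comp_id _) ?_ m
  simp

/-- Pulling back along `Φ` is precomposition with the functor induced by `Φ` on categories of
points. -/
lemma act_pullbackObj {Y : GpdPresheaf.{v₁, u₁} κ} (Φ : X ⟶ Y) (M : Sh.{w} T Y) {R S : Rings κ}
    (f : R ⟶ S) {x : X.obj R} {x' : X.obj S} (α : (X.res f).obj x ⟶ x')
    (m : (pullbackObj Φ M).obj R x) : (pullbackObj Φ M).act f α m =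
      M.act f (eqToHom (naturality_obj Φ f x) ≫ (GpdPresheaf.at Φ S).map α) m := by
  change M.ψ ((GpdPresheaf.at Φ S).map α) (M.θ f (naturality_obj Φ f x) m) =
    M.ψ (_ ≫ _) (M.θ f rfl m)
  rw [M.ψ_comp]
  exact congrArg _ (M.ψ_eqToHom_θ f rfl (naturality_obj Φ f x) m).symm

end Sh

/-! ### Points of `X` over a point of `Y` -/

/-- A point `pt` of `X` over an algebra `hom : R ⟶ ring`, with an identification of its image with
the restriction of the point `y` of `Y`. -/
structure DescentPoint (Φ : X ⟶ Y) {R : Rings κ} (y : Y.obj R) where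
  ring : Rings κ
  hom : R ⟶ ring
  pt : X.obj ring
  iso : (Y.res hom).obj y ⟶ (GpdPresheaf.at Φ ring).obj pt

namespace DescentPoint

variable {Φ : X ⟶ Y} {R : Rings κ} {y : Y.obj R}

/-- The restriction of a point along a ring map. -/
abbrev restrict (p : DescentPoint Φ y) {S : Rings κ} (g : p.ring ⟶ S) : DescentPoint Φ y where
  ring := S
  hom := p.hom ≫ g
  pt := (X.res g).obj p.pt
  iso := eqToHom (res_comp_obj _ _ _) ≫ (Y.res g).map p.iso ≫ eqToHom (naturality_obj Φ g p.pt)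

/-- The action of the map of points `(R, y) ⟶ (R', y')` of `Y` given by `f` and `γ`: a point over
`y'` is a point over `y`. -/
abbrev reindex {R' : Rings κ} (f : R ⟶ R') {y' : Y.obj R'} (γ : (Y.res f).obj y ⟶ y')
    (p : DescentPoint Φ y') : DescentPoint Φ y where
  ring := p.ring
  hom := f ≫ p.hom
  pt := p.pt
  iso := eqToHom (res_comp_obj _ _ _) ≫ (Y.res p.hom).map γ ≫ p.iso

/-- Compatibility of a morphism `β : X(g)(p) ⟶ q` with the identifications with `y`. -/
def IsOver (p q : DescentPoint Φ y) (g : p.ring ⟶ q.ring) (hg : p.hom ≫ g = q.hom)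
    (β : (X.res g).obj p.pt ⟶ q.pt) : Prop :=
  (GpdPresheaf.at Φ q.ring).map β = eqToHom (naturality_obj Φ g p.pt).symm ≫
    (Y.res g).map (Groupoid.inv p.iso) ≫ eqToHom (res_comp_obj_of_eq hg y).symm ≫ q.iso

lemma isOver_restrict (p : DescentPoint Φ y) {S : Rings κ} (g : p.ring ⟶ S) :
    IsOver p (p.restrict g) g rfl (𝟙 _) := by
  unfold IsOver
  simp

lemma isOver_id (p : DescentPoint Φ y) :
    IsOver p p (𝟙 _) (Category.comp_id _) (eqToHom (res_id_obj p.pt)) := by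
  rw [IsOver]
  simp [eqToHom_map, res_id_map]

lemma IsOver.comp {p q r : DescentPoint Φ y} {g : p.ring ⟶ q.ring} {hg : p.hom ≫ g = q.hom}
    {β : (X.res g).obj p.pt ⟶ q.pt} (hβ : IsOver p q g hg β) {h : q.ring ⟶ r.ring}
    {hh : q.hom ≫ h = r.hom} {γ : (X.res h).obj q.pt ⟶ r.pt} (hγ : IsOver q r h hh γ) :
    IsOver p r (g ≫ h) (by rw [← Category.assoc, hg, hh])
      (eqToHom (res_comp_obj g h p.pt) ≫ (X.res h).map β ≫ γ) := by
  rw [IsOver] at hβ hγ ⊢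
  rw [Functor.map_comp, Functor.map_comp, naturality_map, hβ, hγ]
  simp [eqToHom_map, res_comp_map]

lemma IsOver.reindex {R' : Rings κ} (f : R ⟶ R') {y' : Y.obj R'} (γ : (Y.res f).obj y ⟶ y')
    {p q : DescentPoint Φ y'} {g : p.ring ⟶ q.ring} {hg : p.hom ≫ g = q.hom}
    {β : (X.res g).obj p.pt ⟶ q.pt} (hβ : IsOver p q g hg β) :
    IsOver (p.reindex f γ) (q.reindex f γ) g
      (by rw [Category.assoc, hg]) β := by
  unfold IsOver at hβ ⊢
  refine hβ.trans ?_
  obtain ⟨A, a, x, i⟩ := p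
  obtain ⟨B, b, z, j⟩ := q
  dsimp only at g hg β hβ
  subst hg
  simp [DescentPoint.reindex, res_comp_map, eqToHom_map]

variable (hΦ : ∀ S, (GpdPresheaf.at Φ S).FullyFaithful)

/-- The unique morphism compatible with the identifications with `y`. -/
def transHom (p q : DescentPoint Φ y) (g : p.ring ⟶ q.ring) (hg : p.hom ≫ g = q.hom) :
    (X.res g).obj p.pt ⟶ q.pt :=
  (hΦ q.ring).preimage (eqToHom (naturality_obj Φ g p.pt).symm ≫
    (Y.res g).map (Groupoid.inv p.iso) ≫ eqToHom (res_comp_obj_of_eq hg y).symm ≫ q.iso)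

lemma isOver_transHom (p q : DescentPoint Φ y) (g : p.ring ⟶ q.ring) (hg : p.hom ≫ g = q.hom) :
    IsOver p q g hg (transHom hΦ p q g hg) :=
  (hΦ q.ring).map_preimage _

lemma IsOver.eq_transHom {p q : DescentPoint Φ y} {g : p.ring ⟶ q.ring} {hg : p.hom ≫ g = q.hom}
    {β : (X.res g).obj p.pt ⟶ q.pt} (hβ : IsOver p q g hg β) : β = transHom hΦ p q g hg :=
  (hΦ q.ring).map_injective (hβ.trans (isOver_transHom hΦ p q g hg).symm)

end DescentPoint

namespace Sh

variable {Φ : X ⟶ Y} (hΦ : ∀ S, (GpdPresheaf.at Φ S).FullyFaithful) (M : Sh.{w} T X)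
  {R : Rings κ} {y : Y.obj R}

/-- The transition map of a sheaf on `X` between points over the point `y` of `Y`. -/
def trans (p q : DescentPoint Φ y) (g : p.ring ⟶ q.ring) (hg : p.hom ≫ g = q.hom) :
    M.obj p.ring p.pt →ₛₗ[Rings.toRingHom g] M.obj q.ring q.pt :=
  M.act g (p.transHom hΦ q g hg)

lemma trans_eq_act {p q : DescentPoint Φ y} {g : p.ring ⟶ q.ring} {hg : p.hom ≫ g = q.hom}
    {β : (X.res g).obj p.pt ⟶ q.pt} (hβ : p.IsOver q g hg β) :
    M.trans hΦ p q g hg = M.act g β := by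
  rw [trans, hβ.eq_transHom hΦ]

lemma trans_restrict (p : DescentPoint Φ y) {S : Rings κ} (g : p.ring ⟶ S)
    (m : M.obj p.ring p.pt) :
    M.trans hΦ p (p.restrict g) g rfl m = M.θ g rfl m := by
  rw [M.trans_eq_act hΦ (p.isOver_restrict g), act_apply]
  exact M.ψ_id _

lemma trans_id (p : DescentPoint Φ y) (m : M.obj p.ring p.pt) :
    M.trans hΦ p p (𝟙 _) (Category.comp_id _) m = m := by
  rw [M.trans_eq_act hΦ p.isOver_id, act_eqToHom, M.θ_id]

lemma trans_trans (p q r : DescentPoint Φ y) {g : p.ring ⟶ q.ring} (hg : p.hom ≫ g = q.hom)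
    {h : q.ring ⟶ r.ring} (hh : q.hom ≫ h = r.hom) (m : M.obj p.ring p.pt) :
    M.trans hΦ q r h hh (M.trans hΦ p q g hg m) =
      M.trans hΦ p r (g ≫ h) (by rw [← Category.assoc, hg, hh]) m := by
  rw [M.trans_eq_act hΦ ((p.isOver_transHom hΦ q g hg).comp (q.isOver_transHom hΦ r h hh)),
    trans, trans, act_comp]

lemma trans_reindex {R' : Rings κ} (f : R ⟶ R') {y' : Y.obj R'} (γ : (Y.res f).obj y ⟶ y')
    (p q : DescentPoint Φ y') (g : p.ring ⟶ q.ring) (hg : p.hom ≫ g = q.hom)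
    (hg' : (p.reindex f γ).hom ≫ g = (q.reindex f γ).hom) (m : M.obj p.ring p.pt) :
    M.trans hΦ (p.reindex f γ) (q.reindex f γ) g hg' m = M.trans hΦ p q g hg m :=
  congrArg (· m) (M.trans_eq_act hΦ ((p.isOver_transHom hΦ q g hg).reindex f γ))

end Sh

/-! ### The descent system of a quasi-coherent sheaf -/

/-- `Rings κ` is closed under tensor products. For `κ = ℵ₀` this uses that the tensor product of
finite algebras is finite, for larger `κ` that it is covered by lists of pairs. -/
lemma mk_tensorProduct_lt (hκ : Cardinal.aleph0 ≤ κ) {R A B : Type u} [CommRing R] [CommRing A]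
    [CommRing B] [Algebra R A] [Algebra R B] (hA : #A < κ) (hB : #B < κ) : #(A ⊗[R] B) < κ := by
  by_cases h : Cardinal.aleph0 = κ
  · subst h
    have := Cardinal.lt_aleph0_iff_finite.mp hA
    have := Cardinal.lt_aleph0_iff_finite.mp hB
    have := Module.Finite.of_finite (R := R) (M := B) 
    have : Finite (A ⊗[R] B) := Module.finite_of_finite A
    exact Cardinal.lt_aleph0_of_finite _
  · have hs : Function.Surjective
        fun l : List (A × B) => (l.map fun x => x.1 ⊗ₜ[R] x.2).sum := fun x => by
      induction x with
      | zero => exact ⟨[], rfl⟩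
      | add x y hx hy =>
        obtain ⟨l, rfl⟩ := hx
        obtain ⟨l', rfl⟩ := hy
        exact ⟨l ++ l', by simp⟩
      | tmul a b => exact ⟨[(a, b)], by simp⟩
    refine (Cardinal.mk_le_of_surjective hs).trans_lt ((Cardinal.mk_list_le_max _).trans_lt ?_)
    refine max_lt (lt_of_le_of_ne hκ h) ?_
    rw [Cardinal.mk_prod, Cardinal.lift_id, Cardinal.lift_id]
    exact Cardinal.mul_lt_of_lt hκ hA hB

/-- If `N` is the base change of the `B`-module `M` along `B → A ⊗[R] B`, then it is the base change
of the `R`-module `M` along `R → A`. No `R`-module structure on `N` is fixed here, since the one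
arising for descent points is not the one induced by the canonical algebra structure of
`A ⊗[R] B`. -/
lemma exists_addEquiv_of_isBaseChangeAlong {R A B M N : Type*} [CommRing R] [CommRing A]
    [CommRing B] [Algebra R A] [Algebra R B] [AddCommGroup M] [AddCommGroup N] [Module R M]
    [Module B M] [IsScalarTower R B M] [Module (A ⊗[R] B) N]
    (θ : M →ₛₗ[(Algebra.TensorProduct.includeRight : B →ₐ[R] A ⊗[R] B).toRingHom] N)
    (hθ : IsBaseChangeAlong _ θ) :
    ∃ e : A ⊗[R] M ≃+ N, ∀ a m, e (a ⊗ₜ m) = (a ⊗ₜ[R] (1 : B)) • θ m := by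
  let : Algebra B (A ⊗[R] B) := Algebra.TensorProduct.rightAlgebra
  let : Module B N := Module.compHom N (algebraMap B (A ⊗[R] B))
  have : IsScalarTower B (A ⊗[R] B) N := ⟨fun r s n => mul_smul (algebraMap B (A ⊗[R] B) r) s n⟩
  refine ⟨(Algebra.IsPushout.cancelBaseChange R A B (A ⊗[R] B) M).symm.toAddEquiv.trans
    (IsBaseChange.equiv hθ).toAddEquiv, fun a m => ?_⟩
  exact (congrArg (IsBaseChange.equiv hθ)
    (Algebra.IsPushout.cancelBaseChange_symm_tmul R A B (A ⊗[R] B) M a m)).trans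
    (IsBaseChange.equiv_tmul hθ _ _)

namespace DescentPoint

variable {Φ : X ⟶ Y} {R : Rings κ} {y : Y.obj R}

/-- The underlying ring of the algebra carrying a point. -/
abbrev carrier (p : DescentPoint Φ y) : Type u := p.ring.carrier

instance (p : DescentPoint Φ y) : Algebra R.carrier p.carrier := (Rings.toRingHom p.hom).toAlgebra

/-- The morphism of `Rings κ` underlying an algebra homomorphism. -/
def ofAlgHom {p q : DescentPoint Φ y} (g : p.carrier →ₐ[R.carrier] q.carrier) : p.ring ⟶ q.ring :=
  ObjectProperty.homMk (CommRingCat.ofHom g.toRingHom)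

/-- The algebra homomorphism given by a morphism of `Rings κ` under `R`. -/
def toAlgHom {p q : DescentPoint Φ y} (g : p.ring ⟶ q.ring) (hg : p.hom ≫ g = q.hom) :
    p.carrier →ₐ[R.carrier] q.carrier :=
  AlgHom.mk (Rings.toRingHom g) fun r => congrArg (fun k => Rings.toRingHom k r) hg

lemma hom_ofAlgHom {p q : DescentPoint Φ y} (g : p.carrier →ₐ[R.carrier] q.carrier) :
    p.hom ≫ ofAlgHom g = q.hom := by
  ext r
  exact g.commutes r

end DescentPoint

namespace Sh

/-- The fibre of a sheaf over `X` at a point over `y`, as a module over its ring and over the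
base. -/
def fib {T : Coverage κ} {Φ : X ⟶ Y} {R : Rings κ} {y : Y.obj R} (M : Sh.{w} T X)
    (p : DescentPoint Φ y) : Type w :=
  M.obj p.ring p.pt

variable {T : Coverage κ} {Φ : X ⟶ Y} {R : Rings κ} {y : Y.obj R} (M : Sh.{w} T X)
    (p : DescentPoint Φ y)

instance : AddCommGroup (M.fib p) := inferInstanceAs (AddCommGroup (M.obj p.ring p.pt))
instance : Module p.carrier (M.fib p) := inferInstanceAs (Module p.carrier (M.obj p.ring p.pt))
instance : Module R.carrier (M.fib p) := Module.compHom (M.fib p) (Rings.toRingHom p.hom)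
instance : IsScalarTower R.carrier p.carrier (M.fib p) :=
  ⟨fun r s m => mul_smul (Rings.toRingHom p.hom r) s m⟩

end Sh

namespace DescentPoint

variable {Φ : X ⟶ Y} {R : Rings κ} {y : Y.obj R} (hκ : Cardinal.aleph0 ≤ κ)

/-- The tensor product of the rings of two points, as an object of `Rings κ`. -/
abbrev tensor (p q : DescentPoint Φ y) : Rings κ :=
  ⟨CommRingCat.of (p.carrier ⊗[R.carrier] q.carrier),
    mk_tensorProduct_lt hκ p.ring.property q.ring.property⟩

/-- The second inclusion into the tensor product, as a morphism of `Rings κ`. -/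
abbrev toTensor (p q : DescentPoint Φ y) : q.ring ⟶ p.tensor hκ q :=
  ObjectProperty.homMk (CommRingCat.ofHom
    (Algebra.TensorProduct.includeRight : q.carrier →ₐ[R.carrier] _).toRingHom)

/-- The restriction of the second of two points to the tensor product of their rings. -/
def prod (p q : DescentPoint Φ y) : DescentPoint Φ y := q.restrict (p.toTensor hκ q)

/-- The first inclusion into the ring of `prod p q`. -/
def inl (p q : DescentPoint Φ y) : p.carrier →ₐ[R.carrier] (p.prod hκ q).carrier :=
  AlgHom.mk (Algebra.TensorProduct.includeLeft :
      p.carrier →ₐ[R.carrier] p.carrier ⊗[R.carrier] q.carrier).toRingHom fun r =>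
    Algebra.TensorProduct.tmul_one_eq_one_tmul r

/-- The second inclusion into the ring of `prod p q`. -/
def inr (p q : DescentPoint Φ y) : q.carrier →ₐ[R.carrier] (p.prod hκ q).carrier :=
  AlgHom.mk (Algebra.TensorProduct.includeRight :
      q.carrier →ₐ[R.carrier] p.carrier ⊗[R.carrier] q.carrier).toRingHom fun _ => rfl

/-- The map out of the ring of `prod p q` given by maps out of the two factors. -/
def lift {p q r : DescentPoint Φ y} (g : p.carrier →ₐ[R.carrier] r.carrier)
    (h : q.carrier →ₐ[R.carrier] r.carrier) :
    (p.prod hκ q).carrier →ₐ[R.carrier] r.carrier :=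
  AlgHom.mk (Algebra.TensorProduct.lift g h fun _ _ => Commute.all _ _).toRingHom fun s => by
    change Algebra.TensorProduct.lift g h _ (1 ⊗ₜ algebraMap R.carrier q.carrier s) = _
    rw [Algebra.TensorProduct.lift_tmul, map_one, one_mul, AlgHom.commutes]

end DescentPoint

section DescentSystem

variable {Φ : X ⟶ Y} {R : Rings κ} (y : Y.obj R)

/-- The transition map of a sheaf along an algebra homomorphism between the rings of two points. -/
def Sh.transLinear {T : Coverage κ} {y : Y.obj R} (hΦ : ∀ S, (GpdPresheaf.at Φ S).FullyFaithful)
    (M : Sh.{w} T X) {p q : DescentPoint Φ y} (g : p.carrier →ₐ[R.carrier] q.carrier) :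
    M.fib p →ₗ[R.carrier] M.fib q where
  toFun := M.trans hΦ p q (DescentPoint.ofAlgHom g) (DescentPoint.hom_ofAlgHom g)
  map_add' := map_add _
  map_smul' r m := by
    refine (LinearMap.map_smulₛₗ (M.trans hΦ p q (DescentPoint.ofAlgHom g)
      (DescentPoint.hom_ofAlgHom g)) (algebraMap R.carrier p.carrier r) m).trans ?_
    exact congrArg (· • M.trans hΦ p q (DescentPoint.ofAlgHom g)
      (DescentPoint.hom_ofAlgHom g) m) (g.commutes r)

lemma bijective_adjoint_transLinear (hκ : Cardinal.aleph0 ≤ κ) {y : Y.obj R}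
    (hΦ : ∀ S, (GpdPresheaf.at Φ S).FullyFaithful) (M : QCoh.{w} X) (p q : DescentPoint Φ y) :
    Function.Bijective (adjoint (p.inl hκ q) (M.obj.transLinear hΦ (p.inr hκ q))) := by
  let : Module (p.carrier ⊗[R.carrier] q.carrier) (M.obj.fib (p.prod hκ q)) :=
    inferInstanceAs (Module (p.prod hκ q).carrier (M.obj.fib (p.prod hκ q)))
  let θ : M.obj.fib q →ₛₗ[(Algebra.TensorProduct.includeRight :
      q.carrier →ₐ[R.carrier] p.carrier ⊗[R.carrier] q.carrier).toRingHom]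
      M.obj.fib (p.prod hκ q) := M.obj.θ (p.toTensor hκ q) rfl
  obtain ⟨e, he⟩ := exists_addEquiv_of_isBaseChangeAlong θ (M.property (p.toTensor hκ q) rfl)
  convert e.bijective using 1
  funext x
  induction x with
  | zero => rw [map_zero, map_zero]
  | add x y hx hy => rw [map_add, map_add, hx, hy]
  | tmul a m =>
    rw [he]
    exact congrArg (fun n : M.obj.fib (p.prod hκ q) => p.inl hκ q a • n)
      (M.obj.trans_restrict hΦ q (p.toTensor hκ q) m)

/-- The descent system over `R` formed by the fibres of a quasi-coherent sheaf over `X` at the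
points of `X` over a point `y` of `Y`. -/
def descentSystem (hκ : Cardinal.aleph0 ≤ κ) (hΦ : ∀ S, (GpdPresheaf.at Φ S).FullyFaithful)
    (M : QCoh.{w} X) : DescentSystem R.carrier where
  Pt := DescentPoint Φ y
  ring p := p.carrier
  fib p := M.obj.fib p
  tr := M.obj.transLinear hΦ
  tr_smul {p q} g a m := LinearMap.map_smulₛₗ
    (M.obj.trans hΦ p q (DescentPoint.ofAlgHom g) (DescentPoint.hom_ofAlgHom g)) a m
  tr_id {p} m := M.obj.trans_id hΦ p m
  tr_comp {p q r} g h m := (M.obj.trans_trans hΦ p q r (DescentPoint.hom_ofAlgHom g)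
    (DescentPoint.hom_ofAlgHom h) m).symm
  prod := DescentPoint.prod hκ
  inl := DescentPoint.inl hκ
  inr := DescentPoint.inr hκ
  lift := DescentPoint.lift hκ
  lift_inl g h := by
    ext a
    exact (Algebra.TensorProduct.lift_tmul g h (fun _ _ => Commute.all _ _) a 1).trans
      (by rw [map_one, mul_one] : _ = g a)
  lift_inr g h := by
    ext a
    exact (Algebra.TensorProduct.lift_tmul g h (fun _ _ => Commute.all _ _) 1 a).trans
      (by rw [map_one, one_mul] : _ = h a)
  bijective_adjoint := bijective_adjoint_transLinear hκ hΦ M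

end DescentSystem

/-! ### Covers -/

/-- A finite family of points over `y` is a cover if its rings are flat and jointly faithfully flat
over `R`. -/
structure IsPointCover {Φ : X ⟶ Y} {R : Rings κ} {y : Y.obj R} {ι : Type}
    (c : ι → DescentPoint Φ y) : Prop where
  finite : Finite ι
  flat : ∀ i, Module.Flat R.carrier (c i).carrier
  faithfullyFlat : Module.FaithfullyFlat R.carrier (∀ i, (c i).carrier)

lemma IsPointCover.faithfullyFlat_pi {Φ : X ⟶ Y} {R : Rings κ} {y : Y.obj R} {ι : Type}
    {c : ι → DescentPoint Φ y} (hc : IsPointCover c) :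
    (RingHom.pi fun i => Rings.toRingHom (c i).hom).FaithfullyFlat :=
  hc.faithfullyFlat

/-- The essential surjectivity of an internal equivalence provides covers by points of `X`. -/
lemma exists_isPointCover {Φ : X ⟶ Y} (hΦ : IsInternalEquivalence (flatTopology κ) Φ)
    {R : Rings κ} (y : Y.obj R) :
    ∃ (ι : Type) (c : ι → DescentPoint Φ y), IsPointCover c := by
  obtain ⟨ι, S, f, ⟨h₁, h₂, h₃⟩, h⟩ : y ∈ sheafEssImage (flatTopology κ) Φ R := by
    rw [hΦ.sheafEssImage_eq]
    trivial
  choose x α using h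
  exact ⟨ι, fun i => ⟨S i, f i, x i, Groupoid.inv (α i).some⟩, h₁, h₂, h₃⟩

/-- The base change of a point over `y` along a map of points `(R, y) ⟶ (R', y')`. -/
def DescentPoint.baseChange (hκ : Cardinal.aleph0 ≤ κ) {Φ : X ⟶ Y} {R R' : Rings κ} {y : Y.obj R}
    {y' : Y.obj R'} (f : R ⟶ R') (γ : (Y.res f).obj y ⟶ y') (c : DescentPoint Φ y) :
    DescentPoint Φ y' :=
  letI : Algebra R.carrier R'.carrier := (Rings.toRingHom f).toAlgebra
  let S : Rings κ := ⟨CommRingCat.of (R'.carrier ⊗[R.carrier] c.carrier),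
    mk_tensorProduct_lt hκ R'.property c.ring.property⟩
  let a : R' ⟶ S := ObjectProperty.homMk (CommRingCat.ofHom
    (Algebra.TensorProduct.includeLeft : R'.carrier →ₐ[R.carrier] _).toRingHom)
  let b : c.ring ⟶ S := ObjectProperty.homMk (CommRingCat.ofHom
    (Algebra.TensorProduct.includeRight : c.carrier →ₐ[R.carrier] _).toRingHom)
  have e : f ≫ a = c.hom ≫ b := by
    ext r
    exact Algebra.TensorProduct.tmul_one_eq_one_tmul r
  { ring := S
    hom := a
    pt := (X.res b).obj c.pt
    iso := (Y.res a).map (Groupoid.inv γ) ≫ eqToHom ((res_comp_obj f a y).symm.trans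
      (res_comp_obj_of_eq e.symm y)) ≫ (Y.res b).map c.iso ≫ eqToHom (naturality_obj Φ b c.pt) }

/-- The projection from the base change of a point, as a map of points over `y`. -/
def DescentPoint.toBaseChange (hκ : Cardinal.aleph0 ≤ κ) {Φ : X ⟶ Y} {R R' : Rings κ} {y : Y.obj R}
    {y' : Y.obj R'} (f : R ⟶ R') (γ : (Y.res f).obj y ⟶ y') (c : DescentPoint Φ y) :
    c.carrier →ₐ[R.carrier] ((c.baseChange hκ f γ).reindex f γ).carrier :=
  letI : Algebra R.carrier R'.carrier := (Rings.toRingHom f).toAlgebra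
  AlgHom.mk (Algebra.TensorProduct.includeRight :
    c.carrier →ₐ[R.carrier] R'.carrier ⊗[R.carrier] c.carrier).toRingHom fun r =>
      (Algebra.TensorProduct.tmul_one_eq_one_tmul r).symm

lemma IsPointCover.baseChange (hκ : Cardinal.aleph0 ≤ κ) {Φ : X ⟶ Y} {R R' : Rings κ}
    {y : Y.obj R} {y' : Y.obj R'} (f : R ⟶ R') (γ : (Y.res f).obj y ⟶ y') {ι : Type}
    {c : ι → DescentPoint Φ y} (hc : IsPointCover c) :
    IsPointCover fun i => (c i).baseChange hκ f γ := by
  let : Algebra R.carrier R'.carrier := (Rings.toRingHom f).toAlgebra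
  have e : ∀ i, ∃ e : R'.carrier ⊗[R.carrier] (c i).carrier ≃ₗ[R'.carrier]
      ((c i).baseChange hκ f γ).carrier, True := fun i =>
    ⟨{ AddEquiv.refl (R'.carrier ⊗[R.carrier] (c i).carrier) with
        -- The algebra structure of a point comes from `hom`, not from the tensor product.
        map_smul' := fun r x => Algebra.smul_def r x }, trivial⟩
  choose e _ using e
  classical
  have := hc.finite
  have := Fintype.ofFinite ι
  have := hc.faithfullyFlat
  refine ⟨hc.finite, fun i => ?_, ?_⟩
  · have := hc.flat i
    exact Module.Flat.of_linearEquiv (e i).symm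
  · exact Module.FaithfullyFlat.of_linearEquiv _ _
      ((TensorProduct.piRight R.carrier R'.carrier R'.carrier fun i => (c i).carrier) ≪≫ₗ
        LinearEquiv.piCongrRight e).symm

/-! ### Sections over points of `Y` -/

section Sections

variable {Φ : X ⟶ Y} (hκ : Cardinal.aleph0 ≤ κ) (hΦ : ∀ S, (GpdPresheaf.at Φ S).FullyFaithful)
  (M N : QCoh.{w} X)

/-- The sections of a quasi-coherent sheaf on `X` over a point `y` of `Y`: compatible families
indexed by the points of `X` over `y`. -/
abbrev Sections {R : Rings κ} (y : Y.obj R) : Type _ := (descentSystem y hκ hΦ M).sections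

variable {M N hκ hΦ}

namespace Sections

variable {R : Rings κ} {y : Y.obj R}

/-- The value of a section at a point. -/
def val (t : Sections hκ hΦ M y) (p : DescentPoint Φ y) : M.obj.obj p.ring p.pt := t.1 p

lemma ext {t t' : Sections hκ hΦ M y} (h : ∀ p, t.val p = t'.val p) : t = t' :=
  Subtype.ext (funext h)

lemma trans_val (t : Sections hκ hΦ M y) (p q : DescentPoint Φ y) (g : p.ring ⟶ q.ring)
    (hg : p.hom ≫ g = q.hom) : M.obj.trans hΦ p q g hg (t.val p) = t.val q :=
  t.2 p q (DescentPoint.toAlgHom g hg)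

lemma act_val (t : Sections hκ hΦ M y) {p q : DescentPoint Φ y} {g : p.ring ⟶ q.ring}
    {hg : p.hom ≫ g = q.hom} {β : (X.res g).obj p.pt ⟶ q.pt} (hβ : p.IsOver q g hg β) :
    M.obj.act g β (t.val p) = t.val q := by
  rw [← M.obj.trans_eq_act hΦ hβ, trans_val]

/-- A family compatible with the transition maps, as a section. -/
def mk (t : ∀ p : DescentPoint Φ y, M.obj.obj p.ring p.pt)
    (h : ∀ (p q : DescentPoint Φ y) (g : p.ring ⟶ q.ring) (hg : p.hom ≫ g = q.hom),
      M.obj.trans hΦ p q g hg (t p) = t q) : Sections hκ hΦ M y :=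
  ⟨t, fun p q g => h p q _ (DescentPoint.hom_ofAlgHom g)⟩

lemma val_congr (t : Sections hκ hΦ M y) {S : Rings κ} {f g : R ⟶ S} (e : f = g) {x : X.obj S}
    {α : (Y.res f).obj y ⟶ (GpdPresheaf.at Φ S).obj x}
    {β : (Y.res g).obj y ⟶ (GpdPresheaf.at Φ S).obj x}
    (h : α = eqToHom (by rw [e]) ≫ β) : t.val ⟨S, f, x, α⟩ = t.val ⟨S, g, x, β⟩ := by
  subst e
  rw [eqToHom_refl, Category.id_comp] at h
  rw [h]

variable (M) in
/-- Evaluation of sections at a point, as a semilinear map. -/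
def eval (p : DescentPoint Φ y) :
    Sections hκ hΦ M y →ₛₗ[Rings.toRingHom p.hom] M.obj.obj p.ring p.pt where
  toFun t := t.val p
  map_add' _ _ := rfl
  map_smul' _ _ := rfl

/-- The restriction of sections along a map of points `(R, y) ⟶ (R', y')` of `Y`. -/
def map {R' : Rings κ} (f : R ⟶ R') {y' : Y.obj R'} (γ : (Y.res f).obj y ⟶ y') :
    Sections hκ hΦ M y →ₛₗ[Rings.toRingHom f] Sections hκ hΦ M y' where
  toFun t := mk (fun p => t.val (p.reindex f γ)) fun p q g hg => by
    rw [← trans_val t (p.reindex f γ) (q.reindex f γ) g (by rw [Category.assoc, hg])]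
    exact (M.obj.trans_reindex hΦ f γ p q g hg _ _).symm
  map_add' _ _ := rfl
  map_smul' _ _ := rfl

lemma map_val {R' : Rings κ} (f : R ⟶ R') {y' : Y.obj R'} (γ : (Y.res f).obj y ⟶ y')
    (t : Sections hκ hΦ M y) (p : DescentPoint Φ y') :
    (map f γ t).val p = t.val (p.reindex f γ) := rfl

lemma map_id (t : Sections hκ hΦ M y) : map (𝟙 R) (eqToHom (res_id_obj y)) t = t := by
  refine ext fun p => ?_
  rw [map_val]
  refine val_congr t (Category.id_comp _) ?_
  simp [eqToHom_map]

lemma map_map {R' R'' : Rings κ} (f : R ⟶ R') (g : R' ⟶ R'') {y' : Y.obj R'} {y'' : Y.obj R''}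
    (γ : (Y.res f).obj y ⟶ y') (δ : (Y.res g).obj y' ⟶ y'') (t : Sections hκ hΦ M y) :
    map g δ (map f γ t) =
      map (f ≫ g) (eqToHom (res_comp_obj f g y) ≫ (Y.res g).map γ ≫ δ) t := by
  refine ext fun p => ?_
  rw [map_val, map_val, map_val]
  refine val_congr t (Category.assoc _ _ _).symm ?_
  simp [eqToHom_map, res_comp_map]

/-- Functoriality of sections in the sheaf. -/
def mapHom (τ : M ⟶ N) : Sections hκ hΦ M y →ₗ[R.carrier] Sections hκ hΦ N y where
  toFun t := mk (fun p => τ.hom.app p.ring p.pt (t.val p)) fun p q g hg => by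
    rw [← trans_val t p q g hg]
    exact (Sh.Hom.app_act τ.hom _ _ _).symm
  map_add' t t' := ext fun p => map_add (τ.hom.app p.ring p.pt) _ _
  map_smul' r t := ext fun p => map_smul (τ.hom.app p.ring p.pt) (Rings.toRingHom p.hom r) _

/-- Effectivity of descent, for the sections over `y`. -/
lemma isBaseChangeAlong_eval {ι : Type} {c : ι → DescentPoint Φ y} (hc : IsPointCover c) (i : ι) :
    IsBaseChangeAlong (Rings.toRingHom (c i).hom) (eval (hκ := hκ) (hΦ := hΦ) M (c i)) := by
  have := hc.finite
  let c' : ι → (descentSystem y hκ hΦ M).Pt := c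
  have : ∀ i, Module.Flat R.carrier ((descentSystem y hκ hΦ M).ring (c' i)) := hc.flat
  have : Module.FaithfullyFlat R.carrier (∀ i, (descentSystem y hκ hΦ M).ring (c' i)) :=
    hc.faithfullyFlat
  exact (descentSystem y hκ hΦ M).isBaseChange_eval c' i

/-- The family of points over `y` is large, but a section is determined by its values on a cover,
whose index set lies in the lowest universe. -/
lemma small {ι : Type} {c : ι → DescentPoint Φ y} (hc : IsPointCover c) :
    Small.{w} (Sections hκ hΦ M y) := by
  have := hc.finite
  let c' : ι → (descentSystem y hκ hΦ M).Pt := c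
  have : Module.FaithfullyFlat R.carrier (∀ i, (descentSystem y hκ hΦ M).ring (c' i)) :=
    hc.faithfullyFlat
  have h := (descentSystem y hκ hΦ M).injective_eval_cover c'
  exact @small_of_injective _ (∀ i, M.obj.fib (c i)) inferInstance _ h

end Sections

/-- The maps `ψ_α ∘ θ(f)` of a quasi-coherent sheaf are base changes. -/
lemma isBaseChangeAlong_act (M : QCoh.{w} X) {R S : Rings κ} (f : R ⟶ S) {x : X.obj R}
    {x' : X.obj S} (α : (X.res f).obj x ⟶ x') :
    IsBaseChangeAlong (Rings.toRingHom f) (M.obj.act f α) :=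
  (M.property f rfl).of_equiv (LinearEquiv.refl _ _) (M.obj.ψ α) fun _ => rfl

/-- Sections are quasi-coherent: this is checked on the base change of a cover, over which both
sides are given by the sheaf itself. -/
lemma Sections.isBaseChangeAlong_map {R R' : Rings κ} (f : R ⟶ R') {y : Y.obj R} {y' : Y.obj R'}
    (γ : (Y.res f).obj y ⟶ y') {ι : Type} {c : ι → DescentPoint Φ y} (hc : IsPointCover c) :
    IsBaseChangeAlong (Rings.toRingHom f) (map (hκ := hκ) (hΦ := hΦ) (M := M) f γ) := by
  have hd := hc.baseChange hκ f γ
  have := hc.finite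
  refine isBaseChangeAlong_of_faithfullyFlat_family hd.faithfullyFlat_pi _
    (fun i => eval M ((c i).baseChange hκ f γ)) (isBaseChangeAlong_eval hd)
    (fun i => eval M (((c i).baseChange hκ f γ).reindex f γ)) (fun i => ?_) fun i t => rfl
  let g := DescentPoint.ofAlgHom ((c i).toBaseChange hκ f γ)
  have hg : (c i).hom ≫ g = _ := DescentPoint.hom_ofAlgHom ((c i).toBaseChange hκ f γ)
  refine (isBaseChangeAlong_eval hc i).comp (isBaseChangeAlong_act M g
    ((c i).transHom hΦ (((c i).baseChange hκ f γ).reindex f γ) g hg)) ?_ fun t => ?_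
  · exact congrArg Rings.toRingHom hg
  · exact (trans_val t (c i) _ g hg).symm

end Sections

/-! ### Descent for quasi-coherent sheaves on `Y` -/

section Unit

variable {Φ : X ⟶ Y} (hκ : Cardinal.aleph0 ≤ κ) (hΦ : ∀ S, (GpdPresheaf.at Φ S).FullyFaithful)
  (M : QCoh.{w} Y) {R : Rings κ} (y : Y.obj R)

/-- The map from `M_y` to the sections over `y` of `Φ^* M`. -/
def unit : M.obj.obj R y →ₗ[R.carrier] Sections hκ hΦ ((QCoh.pullback Φ).obj M) y where
  toFun m := Sections.mk (fun p => M.obj.act p.hom p.iso m) fun p q g hg => by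
    refine (Sh.act_pullbackObj Φ M.obj g (p.transHom hΦ q g hg) _).trans ?_
    rw [M.obj.act_comp]
    refine Sh.congr_of_eqToHom M.obj.act hg ?_ m
    rw [p.isOver_transHom hΦ q g hg]
    simp
  map_add' m m' := Sections.ext fun p => map_add (M.obj.act p.hom p.iso) _ _
  map_smul' r m := Sections.ext fun p => LinearMap.map_smulₛₗ (M.obj.act p.hom p.iso) _ _

variable {y}

lemma unit_val (m : M.obj.obj R y) (p : DescentPoint Φ y) :
    (unit hκ hΦ M y m).val p = M.obj.act p.hom p.iso m := rfl

lemma map_unit {R' : Rings κ} (f : R ⟶ R') {y' : Y.obj R'} (γ : (Y.res f).obj y ⟶ y')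
    (m : M.obj.obj R y) :
    Sections.map f γ (unit hκ hΦ M y m) = unit hκ hΦ M y' (M.obj.act f γ m) := by
  refine Sections.ext fun p => ?_
  rw [Sections.map_val, unit_val, unit_val, M.obj.act_comp]

/-- Descent for `M`: the sheaf is determined by its restriction to `X`. Over a cover both sides are
given by the restriction of `M`. -/
lemma bijective_unit {ι : Type} {c : ι → DescentPoint Φ y} (hc : IsPointCover c) :
    Function.Bijective (unit hκ hΦ M y) := by
  have := hc.finite
  have := hc.faithfullyFlat
  have h : IsBaseChange R.carrier (unit hκ hΦ M y) :=
    isBaseChange_of_faithfullyFlat_family (T := fun i => (c i).carrier)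
      (P := fun i => ((QCoh.pullback Φ).obj M).obj.fib (c i)) (unit hκ hΦ M y)
      (fun i => (descentSystem y hκ hΦ ((QCoh.pullback Φ).obj M)).eval (c i))
      (Sections.isBaseChangeAlong_eval hc)
      fun i => isBaseChangeAlong_act M (c i).hom (c i).iso
  have e : (unit hκ hΦ M y : M.obj.obj R y → _) =
      h.equiv ∘ (TensorProduct.lid R.carrier (M.obj.obj R y)).symm := by
    funext m
    simp [IsBaseChange.equiv_tmul]
  rw [e]
  exact h.equiv.bijective.comp (LinearEquiv.bijective _)

end Unit

/-! ### The sheaf of sections -/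

section Pushforward

variable {Φ : X ⟶ Y} (hκ : Cardinal.aleph0 ≤ κ) (hΦ : ∀ S, (GpdPresheaf.at Φ S).FullyFaithful)
  (hc : ∀ {R : Rings κ} (y : Y.obj R), ∃ (ι : Type) (c : ι → DescentPoint Φ y), IsPointCover c)
  (M : QCoh.{w} X)

include hc in
lemma small_sections {R : Rings κ} (y : Y.obj R) : Small.{w} (Sections hκ hΦ M y) := by
  obtain ⟨_, _, h⟩ := hc y
  exact Sections.small h

/-- The module of sections over `y`, in the universe of the fibres of `M`. -/
noncomputable def pushforwardFib {R : Rings κ} (y : Y.obj R) : ModuleCat.{w} R.carrier :=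
  haveI := small_sections hκ hΦ hc M y
  ModuleCat.of R.carrier (Shrink.{w} (Sections hκ hΦ M y))

/-- The identification of `pushforwardFib` with the module of sections. -/
noncomputable def pushforwardEquiv {R : Rings κ} (y : Y.obj R) :
    pushforwardFib hκ hΦ hc M y ≃ₗ[R.carrier] Sections hκ hΦ M y :=
  haveI := small_sections hκ hΦ hc M y
  Shrink.linearEquiv.{w} R.carrier (Sections hκ hΦ M y)

/-- The transport of `Sections.map` to `pushforwardFib`. -/
noncomputable def pushforwardMap {R S : Rings κ} (f : R ⟶ S) {y : Y.obj R} {z : Y.obj S}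
    (γ : (Y.res f).obj y ⟶ z) :
    pushforwardFib hκ hΦ hc M y →ₛₗ[Rings.toRingHom f] pushforwardFib hκ hΦ hc M z :=
  (pushforwardEquiv hκ hΦ hc M z).symm.toLinearMap.comp
    ((Sections.map f γ).comp (pushforwardEquiv hκ hΦ hc M y).toLinearMap)

lemma pushforwardEquiv_map {R S : Rings κ} (f : R ⟶ S) {y : Y.obj R} {z : Y.obj S}
    (γ : (Y.res f).obj y ⟶ z) (t : pushforwardFib hκ hΦ hc M y) :
    pushforwardEquiv hκ hΦ hc M z (pushforwardMap hκ hΦ hc M f γ t) =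
      Sections.map f γ (pushforwardEquiv hκ hΦ hc M y t) :=
  LinearEquiv.apply_symm_apply _ _

lemma pushforwardMap_id {R : Rings κ} {y : Y.obj R} (t : pushforwardFib hκ hΦ hc M y) :
    pushforwardMap hκ hΦ hc M (𝟙 R) (eqToHom (res_id_obj y)) t = t := by
  apply (pushforwardEquiv hκ hΦ hc M y).injective
  rw [pushforwardEquiv_map, Sections.map_id]

lemma pushforwardMap_comp {R S S' : Rings κ} (f : R ⟶ S) (g : S ⟶ S') {x : Y.obj R}
    {y : Y.obj S} {z : Y.obj S'} (α : (Y.res f).obj x ⟶ y) (β : (Y.res g).obj y ⟶ z)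
    (t : pushforwardFib hκ hΦ hc M x) :
    pushforwardMap hκ hΦ hc M g β (pushforwardMap hκ hΦ hc M f α t) =
      pushforwardMap hκ hΦ hc M (f ≫ g)
        (eqToHom (res_comp_obj f g x) ≫ (Y.res g).map α ≫ β) t := by
  apply (pushforwardEquiv hκ hΦ hc M z).injective
  rw [pushforwardEquiv_map, pushforwardEquiv_map, pushforwardEquiv_map, Sections.map_map]

lemma isBaseChangeAlong_pushforwardMap {R S : Rings κ} (f : R ⟶ S) {y : Y.obj R} {z : Y.obj S}
    (γ : (Y.res f).obj y ⟶ z) :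
    IsBaseChangeAlong (Rings.toRingHom f) (pushforwardMap hκ hΦ hc M f γ) := by
  obtain ⟨_, _, h⟩ := hc y
  exact (Sections.isBaseChangeAlong_map f γ h).of_equiv (pushforwardEquiv hκ hΦ hc M y).symm
    (pushforwardEquiv hκ hΦ hc M z).symm fun t =>
      congrArg (fun s => (pushforwardEquiv hκ hΦ hc M z).symm (Sections.map f γ s))
        (LinearEquiv.apply_symm_apply _ t)

/-- The quasi-coherent sheaf on `Y` formed by the sections of a quasi-coherent sheaf on `X`. -/
noncomputable def pushforward : QCoh.{w} Y where
  obj := Sh.ofAct (fun _ y => pushforwardFib hκ hΦ hc M y) (pushforwardMap hκ hΦ hc M)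
    (pushforwardMap_id hκ hΦ hc M) (pushforwardMap_comp hκ hΦ hc M)
  property f _ _ h := isBaseChangeAlong_pushforwardMap hκ hΦ hc M f (eqToHom h)

/-- The point of `X` over `Φ x` given by `x` itself. -/
abbrev DescentPoint.self (Φ : X ⟶ Y) {R : Rings κ} (x : X.obj R) :
    DescentPoint Φ ((GpdPresheaf.at Φ R).obj x) :=
  ⟨R, 𝟙 R, x, eqToHom (res_id_obj _)⟩

/-- The point `x` is initial among the points over `Φ x`. -/
lemma bijective_val_self {R : Rings κ} (x : X.obj R) :
    Function.Bijective fun t : Sections hκ hΦ M ((GpdPresheaf.at Φ R).obj x) =>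
      t.val (DescentPoint.self Φ x) :=
  (descentSystem _ hκ hΦ M).bijective_eval_of_initial (DescentPoint.self Φ x)
    (fun r => ⟨r, rfl⟩) fun q => DescentPoint.toAlgHom (p := DescentPoint.self Φ x)
      q.hom (Category.id_comp q.hom)

/-- Evaluation of the sections over `Φ x` at `x`. -/
noncomputable def counitEquiv {R : Rings κ} (x : X.obj R) :
    pushforwardFib hκ hΦ hc M ((GpdPresheaf.at Φ R).obj x) ≃ₗ[R.carrier] M.obj.obj R x :=
  pushforwardEquiv hκ hΦ hc M _ ≪≫ₗ
    LinearEquiv.ofBijective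
      ({ toFun := fun t => t.val (DescentPoint.self Φ x)
         map_add' := fun _ _ => rfl
         map_smul' := fun _ _ => rfl } :
        Sections hκ hΦ M ((GpdPresheaf.at Φ R).obj x) →ₗ[R.carrier] M.obj.obj R x)
      (bijective_val_self hκ hΦ M x)

lemma counitEquiv_apply {R : Rings κ} (x : X.obj R)
    (t : pushforwardFib hκ hΦ hc M ((GpdPresheaf.at Φ R).obj x)) :
    counitEquiv hκ hΦ hc M x t =
      (pushforwardEquiv hκ hΦ hc M _ t).val (DescentPoint.self Φ x) := rfl

lemma isOver_self_reindex {R S : Rings κ} (f : R ⟶ S) {x : X.obj R} {x' : X.obj S}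
    (α : (X.res f).obj x ⟶ x') :
    (DescentPoint.self Φ x).IsOver ((DescentPoint.self Φ x').reindex f
      (eqToHom (naturality_obj Φ f x) ≫ (GpdPresheaf.at Φ S).map α)) f
      ((Category.id_comp f).trans (Category.comp_id f).symm) α := by
  unfold DescentPoint.IsOver
  simp [eqToHom_map, res_id_map]

lemma counitEquiv_act {R S : Rings κ} (f : R ⟶ S) {x : X.obj R} {x' : X.obj S}
    (α : (X.res f).obj x ⟶ x')
    (t : pushforwardFib hκ hΦ hc M ((GpdPresheaf.at Φ R).obj x)) :
    counitEquiv hκ hΦ hc M x'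
      (((QCoh.pullback Φ).obj (pushforward hκ hΦ hc M)).obj.act f α t) =
      M.obj.act f α (counitEquiv hκ hΦ hc M x t) := by
  have h : ((QCoh.pullback Φ).obj (pushforward hκ hΦ hc M)).obj.act f α t =
      pushforwardMap hκ hΦ hc M f (eqToHom (naturality_obj Φ f x) ≫ (GpdPresheaf.at Φ S).map α) t :=
    (Sh.act_pullbackObj Φ (pushforward hκ hΦ hc M).obj f α t).trans (Sh.act_ofAct _ _
      (pushforwardMap_id hκ hΦ hc M) (pushforwardMap_comp hκ hΦ hc M) _ _ _)
  rw [h, counitEquiv_apply, pushforwardEquiv_map, counitEquiv_apply]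
  exact (Sections.act_val _ (isOver_self_reindex f α)).symm

/-- The isomorphism from the restriction to `X` of the sheaf of sections of `M` to `M`. -/
noncomputable def counitIso : (QCoh.pullback Φ).obj (pushforward hκ hΦ hc M) ≅ M where
  hom := ObjectProperty.homMk (Sh.Hom.ofAct (fun _ x => (counitEquiv hκ hΦ hc M x).toLinearMap)
    fun f _ _ α t => counitEquiv_act hκ hΦ hc M f α t)
  inv := ObjectProperty.homMk (Sh.Hom.ofAct
    (fun _ x => (counitEquiv hκ hΦ hc M x).symm.toLinearMap) fun f x x' α m => by
      apply (counitEquiv hκ hΦ hc M x').injective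
      refine (LinearEquiv.apply_symm_apply _ _).trans ?_
      refine Eq.trans ?_ (counitEquiv_act hκ hΦ hc M f α _).symm
      exact congrArg (M.obj.act f α)
        (LinearEquiv.apply_symm_apply (counitEquiv hκ hΦ hc M x) m).symm)
  hom_inv_id := by
    apply ObjectProperty.hom_ext
    refine Sh.Hom.ext (funext fun R => funext fun x => LinearMap.ext fun m => ?_)
    exact LinearEquiv.symm_apply_apply (counitEquiv hκ hΦ hc M x) m
  inv_hom_id := by
    apply ObjectProperty.hom_ext
    refine Sh.Hom.ext (funext fun R => funext fun x => LinearMap.ext fun m => ?_)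
    exact LinearEquiv.apply_symm_apply (counitEquiv hκ hΦ hc M x) m

end Pushforward

/-! ### The equivalence -/

section Equivalence

variable {Φ : X ⟶ Y} (hκ : Cardinal.aleph0 ≤ κ) (hΦ : ∀ S, (GpdPresheaf.at Φ S).FullyFaithful)
  (hc : ∀ {R : Rings κ} (y : Y.obj R), ∃ (ι : Type) (c : ι → DescentPoint Φ y), IsPointCover c)

/-- The isomorphism from `M_y` to the sections over `y` of `Φ^* M`. -/
noncomputable def unitEquiv (M : QCoh.{w} Y) {R : Rings κ} (y : Y.obj R) :
    M.obj.obj R y ≃ₗ[R.carrier] Sections hκ hΦ ((QCoh.pullback Φ).obj M) y :=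
  LinearEquiv.ofBijective (unit hκ hΦ M y) (by
    obtain ⟨_, _, h⟩ := hc y
    exact bijective_unit hκ hΦ M h)

include hκ hΦ hc in
lemma faithful_pullback : (QCoh.pullback.{w} Φ).Faithful where
  map_injective {M N σ τ} h := by
    apply ObjectProperty.hom_ext
    refine Sh.Hom.ext (funext fun R => funext fun y => LinearMap.ext fun m => ?_)
    apply (unitEquiv hκ hΦ hc N y).injective
    refine Sections.ext fun p => ?_
    change N.obj.act p.hom p.iso _ = N.obj.act p.hom p.iso _
    refine (Sh.Hom.app_act σ.hom _ _ _).symm.trans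
      (Eq.trans ?_ (Sh.Hom.app_act τ.hom _ _ _))
    exact congrArg (fun a : (QCoh.pullback Φ).obj M ⟶ (QCoh.pullback Φ).obj N =>
      a.hom.app p.ring p.pt (M.obj.act p.hom p.iso m)) h

/-- A map over `Y` inducing a given map `τ` over `X`: the action of `τ` on sections. -/
noncomputable def extend {M N : QCoh.{w} Y}
    (τ : (QCoh.pullback Φ).obj M ⟶ (QCoh.pullback Φ).obj N) : M ⟶ N :=
  ObjectProperty.homMk (Sh.Hom.ofAct
    (fun _ y => ((unitEquiv hκ hΦ hc N y).symm.toLinearMap ∘ₗ Sections.mapHom τ) ∘ₗ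
      (unitEquiv hκ hΦ hc M y).toLinearMap) fun f y y' γ m => by
      apply (unitEquiv hκ hΦ hc N y').injective
      refine (LinearEquiv.apply_symm_apply _ _).trans ?_
      refine Eq.trans ?_ (map_unit hκ hΦ N f γ _)
      refine (congrArg (Sections.mapHom τ) (map_unit hκ hΦ M f γ m).symm).trans ?_
      exact congrArg (Sections.map f γ) (LinearEquiv.apply_symm_apply
        (unitEquiv hκ hΦ hc N y) (Sections.mapHom τ (unit hκ hΦ M y m))).symm)

lemma unit_extend {M N : QCoh.{w} Y}
    (τ : (QCoh.pullback Φ).obj M ⟶ (QCoh.pullback Φ).obj N) {R : Rings κ} (y : Y.obj R)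
    (m : M.obj.obj R y) : unit hκ hΦ N y ((extend hκ hΦ hc τ).hom.app R y m) =
      Sections.mapHom τ (unit hκ hΦ M y m) :=
  (unitEquiv hκ hΦ hc N y).apply_symm_apply _

include hκ hΦ hc in
lemma full_pullback : (QCoh.pullback.{w} Φ).Full where
  map_surjective {M N} τ := by
    refine ⟨extend hκ hΦ hc τ, ObjectProperty.hom_ext _ ?_⟩
    refine Sh.Hom.ext (funext fun R => funext fun x => LinearMap.ext fun m => ?_)
    apply (unitEquiv hκ hΦ hc N _).injective
    refine (unit_extend hκ hΦ hc τ _ m).trans (Sections.ext fun p => ?_)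
    change τ.hom.app p.ring p.pt (M.obj.act p.hom p.iso m) =
      N.obj.act p.hom p.iso (τ.hom.app R x m)
    -- Since `Φ` is full, `p.iso` comes from a morphism over `X`, with which `τ` commutes.
    obtain ⟨β, hβ⟩ : ∃ β : (X.res p.hom).obj x ⟶ p.pt, p.iso =
        eqToHom (naturality_obj Φ p.hom x) ≫ (GpdPresheaf.at Φ p.ring).map β :=
      ⟨(hΦ p.ring).preimage (eqToHom (naturality_obj Φ p.hom x).symm ≫ p.iso), by
        rw [(hΦ p.ring).map_preimage]
        simp⟩
    rw [hβ]
    have hM := Sh.act_pullbackObj Φ M.obj p.hom β m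
    have hN := Sh.act_pullbackObj Φ N.obj p.hom β (τ.hom.app R x m)
    exact (congrArg _ hM.symm).trans ((Sh.Hom.app_act τ.hom p.hom β m).trans hN)

include hκ hΦ hc in
lemma essSurj_pullback : (QCoh.pullback.{w} Φ).EssSurj where
  mem_essImage M := ⟨pushforward hκ hΦ hc M, ⟨counitIso hκ hΦ hc M⟩⟩

end Equivalence

end GroupoidSheaves

theorem theorem3 (κ : Cardinal.{u}) (hκ : Cardinal.aleph0 ≤ κ)
    (X Y : GroupoidSheaves.GpdPresheaf.{v₁, u₁} κ) (Φ : X ⟶ Y)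
    (hΦ : GroupoidSheaves.IsInternalEquivalence (GroupoidSheaves.flatTopology κ) Φ) :
    (GroupoidSheaves.QCoh.pullback.{w} Φ).IsEquivalence := by
  have hff : ∀ S, (GroupoidSheaves.GpdPresheaf.at Φ S).FullyFaithful := fun S =>
    have := hΦ.full S
    have := hΦ.faithful S
    .ofFullyFaithful _
  exact
    { faithful := GroupoidSheaves.faithful_pullback hκ hff (GroupoidSheaves.exists_isPointCover hΦ)
      full := GroupoidSheaves.full_pullback hκ hff (GroupoidSheaves.exists_isPointCover hΦ)
      essSurj := GroupoidSheaves.essSurj_pullback hκ hff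
        (GroupoidSheaves.exists_isPointCover hΦ) }
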